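/- Let $\mathcal H$ be a finite-dimensional complex Hilbert space, $n=\dim\mathcal H$, and let $V\in\mathcal L(\mathcal H\otimes\mathcal H)$ be a multiplicative unitary, i.e. a unitary with $V_{12}V_{13}V_{23}=V_{23}V_{12}$ on $\mathcal H\otimes\mathcal H\otimes\mathcal H$. For $\omega\in\mathcal L(\mathcal H)^*$ put $L(\omega)=(\omega\otimes\mathrm{id})(V)$ and $\rho(\omega)=(\mathrm{id}\otimes\omega)(V)$, and let $S=\{L(\omega)\}$ and $\widehat S=\{\rho(\omega)\}$; these are unital involutive subalgebras of $\mathcal L(\mathcal H)$, and Hopf algebras for the coproducts $\delta(x)=V(x\otimes1)V^*$ on $S$ and $\widehat\delta(x)=V^*(1\otimes x)V$ on $\widehat S$. A vector $\xi$ is fixed if $V(\xi\otimes\eta)=\xi\otimes\eta$ for all $\eta$, and cofixed if $V(\eta\otimes\xi)=\eta\otimes\xi$ for all $\eta$. Assume that $V$ has multiplicity one, i.e. that the space of fixed vectors is one-dimensional. Let $e$ be a fixed unit vector and $\hat e$ the cofixed unit vector with $\langle e,\hat e\rangle=n^{-1/2}$. There is exactly one unitary $U$ of $\mathcal H$ with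 $U(xe)=\kappa(x)e$ for $x\in S$, where $\kappa:L(\omega)\mapsto(\omega\otimes\mathrm{id})(V^*)$ is the antipode of $S$. A pre-subgroup of $V$ is a vector $f\in\mathcal H$ with $\|f\|=1$, $\langle f,e\rangle>0$ and $V(f\otimes f)=f\otimes f$. For such $f$ put $H_f=\{\eta: V(\eta\otimes f)=\eta\otimes f\}$, $H^f=\{\eta: V(f\otimes\eta)=f\otimes\eta\}$ and $$D_f=\{x\in S: xe\in UH_f\},\quad G_f=\{x\in S: xe\in H_f\},\quad \widehat D_f=\{x\in\widehat S: x\hat e\in H^f\},\quad \widehat G_f=\{x\in\widehat S: x\hat e\in UH^f\}.$$ A right (resp. left) coideal subalgebra of a Hopf algebra $(A,\delta)$ is a subalgebra $B$ of $A$ containing the unit such that $\delta(B)\subset B\otimes A$ (resp. $\delta(B)\subset A\otimes B$); no stability under the involution is required. a) The map $f\mapsto D_f$ (resp. $f\mapsto G_f$) is a bijection from the set of pre-subgroups of $V$ onto the set of right (resp. left) coideal subalgebras of $S$. The map $f\mapsto\widehat D_f$ (resp. $f\mapsto\widehat G_f$) is a bijection from the set of pre-subgroups of $V$ onto the set of right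 (resp. left) coideal subalgebras of $\widehat S$. b) Every (left or right) coideal subalgebra of $S$ is stable under the involution of $S$. -/

import Mathlib

open scoped TensorProduct

set_option linter.unusedSectionVars false

noncomputable section

namespace MultUnitary

section Slices

variable {M N : Type*} [AddCommGroup M] [Module ℂ M] [FiniteDimensional ℂ M]
  [AddCommGroup N] [Module ℂ N] [FiniteDimensional ℂ N]

/-- The slice map `ω ⊗ id : L(M ⊗ N) → L(N)` of a linear form `ω` on `L(M)`, through the
canonical isomorphism `L(M) ⊗ L(N) ≃ L(M ⊗ N)`; it sends `a ⊗ b` to `ω(a) b`. -/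
def sliceLeft (ω : Module.Dual ℂ (Module.End ℂ M)) :
    Module.End ℂ (M ⊗[ℂ] N) →ₗ[ℂ] Module.End ℂ N :=
  (TensorProduct.lid ℂ (Module.End ℂ N)).toLinearMap ∘ₗ
    LinearMap.rTensor (Module.End ℂ N) ω ∘ₗ (homTensorHomEquiv ℂ M N M N).symm.toLinearMap

/-- The slice map `id ⊗ ω : L(M ⊗ N) → L(M)` of a linear form `ω` on `L(N)`;
it sends `a ⊗ b` to `ω(b) a`. -/
def sliceRight (ω : Module.Dual ℂ (Module.End ℂ N)) :
    Module.End ℂ (M ⊗[ℂ] N) →ₗ[ℂ] Module.End ℂ M :=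
  (TensorProduct.rid ℂ (Module.End ℂ M)).toLinearMap ∘ₗ
    LinearMap.lTensor (Module.End ℂ M) ω ∘ₗ (homTensorHomEquiv ℂ M N M N).symm.toLinearMap

theorem equiv_symm_map (a : Module.End ℂ M) (b : Module.End ℂ N) :
    (homTensorHomEquiv ℂ M N M N).symm (TensorProduct.map a b) = a ⊗ₜ[ℂ] b := by
  rw [LinearEquiv.symm_apply_eq, homTensorHomEquiv_apply]
  rfl

theorem sliceLeft_map (ω : Module.Dual ℂ (Module.End ℂ M)) (a : Module.End ℂ M)
    (b : Module.End ℂ N) : sliceLeft ω (TensorProduct.map a b) = ω a • b := by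
  simp [sliceLeft, equiv_symm_map]

theorem sliceRight_map (ω : Module.Dual ℂ (Module.End ℂ N)) (a : Module.End ℂ M)
    (b : Module.End ℂ N) : sliceRight ω (TensorProduct.map a b) = ω b • a := by
  simp [sliceRight, equiv_symm_map]

theorem end_induction {P : Module.End ℂ (M ⊗[ℂ] N) → Prop}
    (h0 : P 0) (hm : ∀ a b, P (TensorProduct.map a b))
    (ha : ∀ x y, P x → P y → P (x + y)) (T : Module.End ℂ (M ⊗[ℂ] N)) : P T := by
  obtain ⟨t, rfl⟩ := (homTensorHomEquiv ℂ M N M N).surjective T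
  induction t with
  | zero => simpa using h0
  | tmul a b =>
    rw [homTensorHomEquiv_apply]
    exact hm a b
  | add x y hx hy =>
    rw [map_add]
    exact ha _ _ hx hy

end Slices

variable {H : Type*} [NormedAddCommGroup H] [InnerProductSpace ℂ H] [FiniteDimensional ℂ H]

/-- `T₁₂ = T ⊗ 1` on `H ⊗ H ⊗ H`. -/
def leg12 : Module.End ℂ (H ⊗[ℂ] H) →ₗ[ℂ] Module.End ℂ ((H ⊗[ℂ] H) ⊗[ℂ] H) :=
  LinearMap.rTensorHom H

/-- `T₂₃ = 1 ⊗ T` on `H ⊗ H ⊗ H`. -/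
def leg23 : Module.End ℂ (H ⊗[ℂ] H) →ₗ[ℂ] Module.End ℂ ((H ⊗[ℂ] H) ⊗[ℂ] H) :=
  (TensorProduct.assoc ℂ H H H).symm.conj.toLinearMap ∘ₗ LinearMap.lTensorHom H

/-- `T₁₃`: the operator `T` on the first and third factors of `H ⊗ H ⊗ H`, obtained from `T₁₂`
by exchanging the last two factors. -/
def leg13 : Module.End ℂ (H ⊗[ℂ] H) →ₗ[ℂ] Module.End ℂ ((H ⊗[ℂ] H) ⊗[ℂ] H) :=
  (TensorProduct.rightComm ℂ H H H).conj.toLinearMap ∘ₗ LinearMap.rTensorHom H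

theorem leg12_apply (T : Module.End ℂ (H ⊗[ℂ] H)) :
    leg12 T = TensorProduct.map T (1 : Module.End ℂ H) := rfl

theorem leg23_map (a b : Module.End ℂ H) :
    leg23 (TensorProduct.map a b) =
      TensorProduct.map (TensorProduct.map (1 : Module.End ℂ H) a) b := by
  refine TensorProduct.ext_threefold fun x y z => ?_
  simp [leg23, LinearEquiv.conj_apply]

theorem leg13_map (a b : Module.End ℂ H) :
    leg13 (TensorProduct.map a b) =
      TensorProduct.map (TensorProduct.map a (1 : Module.End ℂ H)) b := by
  refine TensorProduct.ext_threefold fun x y z => ?_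
  simp [leg13, LinearEquiv.conj_apply]

end MultUnitary

open MultUnitary in
/-- A multiplicative unitary on the finite-dimensional Hilbert space `H`: a unitary `V` of `H ⊗ H`
such that `V₁₂ V₁₃ V₂₃ = V₂₃ V₁₂`. -/
structure MultiplicativeUnitary (H : Type*) [NormedAddCommGroup H] [InnerProductSpace ℂ H]
    [FiniteDimensional ℂ H] where
  /-- the underlying unitary of `H ⊗ H` -/
  unitary : (H ⊗[ℂ] H) ≃ₗᵢ[ℂ] (H ⊗[ℂ] H)
  pentagon :
    leg12 (unitary.toLinearEquiv : Module.End ℂ (H ⊗[ℂ] H)) *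
        leg13 (unitary.toLinearEquiv : Module.End ℂ (H ⊗[ℂ] H)) *
        leg23 (unitary.toLinearEquiv : Module.End ℂ (H ⊗[ℂ] H)) =
      leg23 (unitary.toLinearEquiv : Module.End ℂ (H ⊗[ℂ] H)) *
        leg12 (unitary.toLinearEquiv : Module.End ℂ (H ⊗[ℂ] H))

namespace MultiplicativeUnitary

open MultUnitary

variable {H : Type*} [NormedAddCommGroup H] [InnerProductSpace ℂ H] [FiniteDimensional ℂ H]

/-- `V` as an element of `L(H ⊗ H)`. -/
def op (V : MultiplicativeUnitary H) : Module.End ℂ (H ⊗[ℂ] H) :=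
  (V.unitary.toLinearEquiv : (H ⊗[ℂ] H) →ₗ[ℂ] (H ⊗[ℂ] H))

/-- The adjoint `V* = V⁻¹` as an element of `L(H ⊗ H)`. -/
def opStar (V : MultiplicativeUnitary H) : Module.End ℂ (H ⊗[ℂ] H) :=
  LinearMap.adjoint V.op

/-- `L(ω) = (ω ⊗ id)(V)`. -/
def L (V : MultiplicativeUnitary H) (ω : Module.Dual ℂ (Module.End ℂ H)) : Module.End ℂ H :=
  sliceLeft ω V.op

/-- `ρ(ω) = (id ⊗ ω)(V)`. -/
def rho (V : MultiplicativeUnitary H) (ω : Module.Dual ℂ (Module.End ℂ H)) : Module.End ℂ H :=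
  sliceRight ω V.op

end MultiplicativeUnitary

namespace MultUnitary

variable {H : Type*} [NormedAddCommGroup H] [InnerProductSpace ℂ H] [FiniteDimensional ℂ H]

/-- For subspaces `P, Q` of `L(H)`, the subspace `P ⊗ Q` of `L(H ⊗ H) = L(H) ⊗ L(H)`,
spanned by the operators `a ⊗ b` with `a ∈ P` and `b ∈ Q`. -/
def tensorSpan (P Q : Submodule ℂ (Module.End ℂ H)) :
    Submodule ℂ (Module.End ℂ (H ⊗[ℂ] H)) :=
  Submodule.span ℂ {T | ∃ a ∈ P, ∃ b ∈ Q, T = TensorProduct.map a b}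

theorem tensorSpan_mul {P Q : Submodule ℂ (Module.End ℂ H)}
    (hP : ∀ a ∈ P, ∀ b ∈ P, a * b ∈ P) (hQ : ∀ a ∈ Q, ∀ b ∈ Q, a * b ∈ Q)
    {S T : Module.End ℂ (H ⊗[ℂ] H)} (hS : S ∈ tensorSpan P Q) (hT : T ∈ tensorSpan P Q) :
    S * T ∈ tensorSpan P Q := by
  have h := Submodule.mul_mem_mul hS hT
  rw [tensorSpan, Submodule.span_mul_span] at h
  refine Submodule.span_mono ?_ h
  rintro _ ⟨_, ⟨a, ha, b, hb, rfl⟩, _, ⟨c, hc, d, hd, rfl⟩, rfl⟩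
  exact ⟨a * c, hP a ha c hc, b * d, hQ b hb d hd, (TensorProduct.map_mul a c b d).symm⟩

theorem sliceLeft_mem {P Q : Submodule ℂ (Module.End ℂ H)} {T : Module.End ℂ (H ⊗[ℂ] H)}
    (hT : T ∈ tensorSpan P Q) (ω : Module.Dual ℂ (Module.End ℂ H)) : sliceLeft ω T ∈ Q := by
  refine (Submodule.span_le.2 ?_ : tensorSpan P Q ≤ Q.comap (sliceLeft ω)) hT
  rintro _ ⟨a, -, b, hb, rfl⟩
  change sliceLeft ω _ ∈ Q
  rw [sliceLeft_map]
  exact Q.smul_mem _ hb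

theorem sliceRight_mem {P Q : Submodule ℂ (Module.End ℂ H)} {T : Module.End ℂ (H ⊗[ℂ] H)}
    (hT : T ∈ tensorSpan P Q) (ω : Module.Dual ℂ (Module.End ℂ H)) : sliceRight ω T ∈ P := by
  refine (Submodule.span_le.2 ?_ : tensorSpan P Q ≤ P.comap (sliceRight ω)) hT
  rintro _ ⟨a, ha, b, -, rfl⟩
  change sliceRight ω _ ∈ P
  rw [sliceRight_map]
  exact P.smul_mem _ ha

/-- An operator belongs to the tensor product of its two spaces of slices. -/
theorem mem_tensorSpan (T : Module.End ℂ (H ⊗[ℂ] H)) {P Q : Submodule ℂ (Module.End ℂ H)}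
    (hQ : ∀ ω, sliceLeft ω T ∈ Q) (hP : ∀ ω, sliceRight ω T ∈ P) : T ∈ tensorSpan P Q := by
  have h1 : T ∈ tensorSpan ⊤ Q := by
    let c := Module.finBasis ℂ (Module.End ℂ H)
    have h : ∀ X : Module.End ℂ (H ⊗[ℂ] H),
        X = ∑ i, TensorProduct.map (c i) (sliceLeft (c.coord i) X) := by
      intro X
      induction X using end_induction
      · simp [TensorProduct.map_zero_right]
      · rename_i a b
        have := congrArg (fun z => TensorProduct.map z b) (c.sum_repr a)
        refine this.symm.trans ?_
        simp only [sliceLeft_map, TensorProduct.map_smul_right, ← TensorProduct.map_smul_left]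
        rw [← TensorProduct.mapBilinear_apply, map_sum, LinearMap.sum_apply]
        simp only [TensorProduct.mapBilinear_apply, TensorProduct.map_smul_left]
        rfl
      · rename_i x y hx hy
        conv_lhs => rw [hx, hy]
        simp [TensorProduct.map_add_right, Finset.sum_add_distrib]
    rw [h T]
    exact Submodule.sum_mem _ fun i _ => Submodule.subset_span ⟨_, trivial, _, hQ _, rfl⟩
  let d := Module.finBasis ℂ Q
  have hD : ∀ j, ∃ D : Module.Dual ℂ (Module.End ℂ H), D ∘ₗ Q.subtype = d.coord j :=
    fun j => LinearMap.exists_extend _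
  choose D hD using hD
  have h2 : T = ∑ j, TensorProduct.map (sliceRight (D j) T) (d j : Module.End ℂ H) := by
    refine Submodule.span_induction (p := fun X _ =>
      X = ∑ j, TensorProduct.map (sliceRight (D j) X) (d j : Module.End ℂ H))
      ?_ ?_ ?_ ?_ h1
    · rintro _ ⟨a, -, s, hs, rfl⟩
      have hs' : s = ∑ j, D j s • (d j : Module.End ℂ H) := by
        have e1 := congrArg Q.subtype (d.sum_repr ⟨s, hs⟩)
        have e2 : ∀ j, D j s = d.repr ⟨s, hs⟩ j := fun j => LinearMap.congr_fun (hD j) ⟨s, hs⟩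
        simp only [e2]
        rw [map_sum] at e1
        exact e1.symm
      simp only [sliceRight_map, TensorProduct.map_smul_left, ← TensorProduct.map_smul_right]
      conv_lhs => rw [hs']
      rw [← TensorProduct.mapBilinear_apply, map_sum]
      simp only [TensorProduct.mapBilinear_apply]
    · simp [TensorProduct.map_zero_left]
    · intro x y _ _ hx hy
      conv_lhs => rw [hx, hy]
      simp [TensorProduct.map_add_left, Finset.sum_add_distrib]
    · intro r x _ hx
      conv_lhs => rw [hx]
      simp [TensorProduct.map_smul_left, Finset.smul_sum]
  rw [h2]
  exact Submodule.sum_mem _ fun j _ => Submodule.subset_span ⟨_, hP _, _, (d j).2, rfl⟩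

/-- Adjoint linear form `ω*(x) = conj (ω (x*))`. -/
def dualStar (ω : Module.Dual ℂ (Module.End ℂ H)) : Module.Dual ℂ (Module.End ℂ H) where
  toFun x := star (ω (LinearMap.adjoint x))
  map_add' x y := by simp
  map_smul' r x := by simp [LinearMap.adjoint.map_smulₛₗ]

theorem adjoint_sliceLeft (ω : Module.Dual ℂ (Module.End ℂ H)) (T : Module.End ℂ (H ⊗[ℂ] H)) :
    LinearMap.adjoint (sliceLeft ω T) = sliceLeft (dualStar ω) (LinearMap.adjoint T) := by
  induction T using end_induction
  · simp
  · rename_i a b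
    rw [TensorProduct.adjoint_map, sliceLeft_map, sliceLeft_map]
    simp [dualStar, LinearMap.adjoint.map_smulₛₗ]
  · rename_i x y hx hy
    simp [hx, hy]

theorem adjoint_sliceRight (ω : Module.Dual ℂ (Module.End ℂ H)) (T : Module.End ℂ (H ⊗[ℂ] H)) :
    LinearMap.adjoint (sliceRight ω T) = sliceRight (dualStar ω) (LinearMap.adjoint T) := by
  induction T using end_induction
  · simp
  · rename_i a b
    rw [TensorProduct.adjoint_map, sliceRight_map, sliceRight_map]
    simp [dualStar, LinearMap.adjoint.map_smulₛₗ]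
  · rename_i x y hx hy
    simp [hx, hy]

/-- The form `ω ⊗ ω'` on `L(H ⊗ H)`. -/
def dualTensor (ω ω' : Module.Dual ℂ (Module.End ℂ H)) : Module.Dual ℂ (Module.End ℂ (H ⊗[ℂ] H)) :=
  ω' ∘ₗ sliceLeft ω

theorem slice_leg13_mul_leg23 (ω ω' : Module.Dual ℂ (Module.End ℂ H))
    (S T : Module.End ℂ (H ⊗[ℂ] H)) :
    sliceLeft (dualTensor ω ω') (leg13 S * leg23 T) = sliceLeft ω S * sliceLeft ω' T := by
  induction S using end_induction
  · simp
  · rename_i a b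
    induction T using end_induction
    · simp
    · rename_i c d
      rw [leg13_map, leg23_map, ← TensorProduct.map_mul, ← TensorProduct.map_mul, sliceLeft_map,
        sliceLeft_map, sliceLeft_map]
      simp [dualTensor, sliceLeft_map, smul_smul, mul_comm]
    · rename_i x y hx hy
      simp [mul_add, hx, hy]
  · rename_i x y hx hy
    simp [add_mul, hx, hy]

theorem slice_leg12_mul_leg13 (ω ω' : Module.Dual ℂ (Module.End ℂ H))
    (S T : Module.End ℂ (H ⊗[ℂ] H)) :
    sliceRight ω (sliceRight ω' (leg12 S * leg13 T)) = sliceRight ω S * sliceRight ω' T := by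
  induction S using end_induction
  · simp
  · rename_i a b
    induction T using end_induction
    · simp
    · rename_i c d
      rw [leg12_apply, leg13_map, ← TensorProduct.map_mul, ← TensorProduct.map_mul,
        sliceRight_map, sliceRight_map, map_smul, sliceRight_map, sliceRight_map]
      simp [smul_smul, mul_comm]
    · rename_i x y hx hy
      simp [mul_add, hx, hy]
  · rename_i x y hx hy
    simp [add_mul, hx, hy]

theorem slice_conj_leg23 (Φ : Module.Dual ℂ (Module.End ℂ (H ⊗[ℂ] H)))
    (X Y : Module.End ℂ (H ⊗[ℂ] H)) :
    ∃ ψ : Module.Dual ℂ (Module.End ℂ H), ∀ T : Module.End ℂ (H ⊗[ℂ] H),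
      sliceLeft Φ (leg12 X * leg23 T * leg12 Y) = sliceLeft ψ T := by
  refine ⟨Φ ∘ₗ LinearMap.mulRight ℂ Y ∘ₗ LinearMap.mulLeft ℂ X ∘ₗ LinearMap.lTensorHom H,
    fun T => ?_⟩
  induction T using end_induction
  · simp
  · rename_i a b
    rw [leg12_apply, leg12_apply, leg23_map, ← TensorProduct.map_mul, ← TensorProduct.map_mul,
      sliceLeft_map, sliceLeft_map]
    simp
    rfl
  · rename_i x y hx hy
    simp [mul_add, add_mul, hx, hy]

theorem slice_conj_leg12 (ω ω' : Module.Dual ℂ (Module.End ℂ H))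
    (X Y : Module.End ℂ (H ⊗[ℂ] H)) :
    ∃ ψ : Module.Dual ℂ (Module.End ℂ H), ∀ T : Module.End ℂ (H ⊗[ℂ] H),
      sliceRight ω (sliceRight ω' (leg23 X * leg12 T * leg23 Y)) = sliceRight ψ T := by
  refine ⟨dualTensor ω ω' ∘ₗ LinearMap.mulRight ℂ Y ∘ₗ LinearMap.mulLeft ℂ X ∘ₗ
    LinearMap.rTensorHom H, fun T => ?_⟩
  induction T using end_induction
  · simp
  · rename_i a b
    have hb : LinearMap.rTensorHom H b = TensorProduct.map b (1 : Module.End ℂ H) := rfl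
    rw [leg12_apply, sliceRight_map]
    simp only [LinearMap.comp_apply, LinearMap.mulRight_apply, LinearMap.mulLeft_apply, hb]
    induction X using end_induction
    · simp
    · rename_i p q
      induction Y using end_induction
      · simp
      · rename_i r s
        rw [leg23_map, leg23_map, ← TensorProduct.map_mul, ← TensorProduct.map_mul,
          ← TensorProduct.map_mul, ← TensorProduct.map_mul,
          ← TensorProduct.map_mul, ← TensorProduct.map_mul, sliceRight_map, map_smul,
          sliceRight_map]
        simp [dualTensor, sliceLeft_map, smul_smul, mul_comm]
      · rename_i x y hx hy
        simp only [map_add, mul_add, hx, hy, add_smul]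
    · rename_i x y hx hy
      simp only [map_add, add_mul, hx, hy, add_smul]
  · rename_i x y hx hy
    simp [mul_add, add_mul, hx, hy]

end MultUnitary

namespace MultiplicativeUnitary

open MultUnitary

variable {H : Type*} [NormedAddCommGroup H] [InnerProductSpace ℂ H] [FiniteDimensional ℂ H]

theorem opStar_eq (V : MultiplicativeUnitary H) :
    V.opStar = (V.unitary.symm.toLinearEquiv : (H ⊗[ℂ] H) →ₗ[ℂ] (H ⊗[ℂ] H)) := by
  symm
  rw [opStar, LinearMap.eq_adjoint_iff]
  intro x y
  have := V.unitary.inner_map_map (V.unitary.symm x) y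
  simpa [op] using this.symm

theorem op_mul_opStar (V : MultiplicativeUnitary H) : V.op * V.opStar = 1 := by
  rw [opStar_eq]
  refine LinearMap.ext fun x => ?_
  simp [op]

theorem opStar_mul_op (V : MultiplicativeUnitary H) : V.opStar * V.op = 1 := by
  rw [opStar_eq]
  refine LinearMap.ext fun x => ?_
  simp [op]

theorem L_mul_L (V : MultiplicativeUnitary H) (ω ω' : Module.Dual ℂ (Module.End ℂ H)) :
    ∃ ψ, V.L ω * V.L ω' = V.L ψ := by
  obtain ⟨ψ, hψ⟩ := slice_conj_leg23 (dualTensor ω ω') V.opStar V.op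
  refine ⟨ψ, ?_⟩
  have h : leg13 V.op * leg23 V.op = leg12 V.opStar * leg23 V.op * leg12 V.op := by
    have hp : leg12 V.op * leg13 V.op * leg23 V.op = leg23 V.op * leg12 V.op := V.pentagon
    have h1 : leg12 V.opStar * leg12 V.op = 1 := by
      rw [leg12_apply, leg12_apply, ← TensorProduct.map_mul, opStar_mul_op, one_mul,
        TensorProduct.map_one]
    rw [mul_assoc, ← hp, ← mul_assoc, ← mul_assoc, h1, one_mul]
  rw [L, L, L, ← hψ, ← h, slice_leg13_mul_leg23]

theorem leg23_mul (S T : Module.End ℂ (H ⊗[ℂ] H)) : leg23 (S * T) = leg23 S * leg23 T := by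
  induction S using end_induction
  · simp
  · rename_i a b
    induction T using end_induction
    · simp
    · rename_i c d
      rw [← TensorProduct.map_mul, leg23_map, leg23_map, leg23_map, ← TensorProduct.map_mul,
        ← TensorProduct.map_mul, one_mul]
    · rename_i x y hx hy
      simp only [mul_add, map_add, hx, hy]
  · rename_i x y hx hy
    simp only [add_mul, map_add, hx, hy]

theorem rho_mul_rho (V : MultiplicativeUnitary H) (ω ω' : Module.Dual ℂ (Module.End ℂ H)) :
    ∃ ψ, V.rho ω * V.rho ω' = V.rho ψ := by
  obtain ⟨ψ, hψ⟩ := slice_conj_leg12 ω ω' V.op V.opStar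
  refine ⟨ψ, ?_⟩
  have h : leg12 V.op * leg13 V.op = leg23 V.op * leg12 V.op * leg23 V.opStar := by
    have hp : leg12 V.op * leg13 V.op * leg23 V.op = leg23 V.op * leg12 V.op := V.pentagon
    have h1 : leg23 V.op * leg23 V.opStar = 1 := by
      rw [← leg23_mul, op_mul_opStar, ← TensorProduct.map_one, leg23_map]
      simp
    rw [← hp, mul_assoc, h1, mul_one]
  rw [rho, rho, rho, ← hψ, ← h, slice_leg12_mul_leg13]

/-- The space `{L(ω)}`. -/
def spaceS (V : MultiplicativeUnitary H) : Submodule ℂ (Module.End ℂ H) where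
  carrier := Set.range V.L
  add_mem' := by
    rintro _ _ ⟨a, rfl⟩ ⟨b, rfl⟩
    exact ⟨a + b, by simp [L, sliceLeft, LinearMap.rTensor_add]⟩
  zero_mem' := ⟨0, by simp [L, sliceLeft]⟩
  smul_mem' := by
    rintro r _ ⟨a, rfl⟩
    exact ⟨r • a, by simp [L, sliceLeft, LinearMap.rTensor_smul]⟩

/-- The space `{ρ(ω)}`. -/
def spaceSHat (V : MultiplicativeUnitary H) : Submodule ℂ (Module.End ℂ H) where
  carrier := Set.range V.rho
  add_mem' := by
    rintro _ _ ⟨a, rfl⟩ ⟨b, rfl⟩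
    exact ⟨a + b, by simp [rho, sliceRight, LinearMap.lTensor_add]⟩
  zero_mem' := ⟨0, by simp [rho, sliceRight]⟩
  smul_mem' := by
    rintro r _ ⟨a, rfl⟩
    exact ⟨r • a, by simp [rho, sliceRight, LinearMap.lTensor_smul]⟩

theorem spaceS_mul (V : MultiplicativeUnitary H) :
    ∀ a ∈ V.spaceS, ∀ b ∈ V.spaceS, a * b ∈ V.spaceS := by
  rintro _ ⟨ω, rfl⟩ _ ⟨ω', rfl⟩
  obtain ⟨ψ, h⟩ := V.L_mul_L ω ω'
  exact ⟨ψ, h.symm⟩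

theorem spaceSHat_mul (V : MultiplicativeUnitary H) :
    ∀ a ∈ V.spaceSHat, ∀ b ∈ V.spaceSHat, a * b ∈ V.spaceSHat := by
  rintro _ ⟨ω, rfl⟩ _ ⟨ω', rfl⟩
  obtain ⟨ψ, h⟩ := V.rho_mul_rho ω ω'
  exact ⟨ψ, h.symm⟩

theorem op_mem (V : MultiplicativeUnitary H) : V.op ∈ tensorSpan V.spaceSHat V.spaceS :=
  mem_tensorSpan _ (fun ω => ⟨ω, rfl⟩) (fun ω => ⟨ω, rfl⟩)

theorem mem_of_mul_mem {A : Type*} [Ring A] [Algebra ℂ A] [FiniteDimensional ℂ A]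
    (W : Submodule ℂ A) {u v : A} (huv : u * v = 1) (h : ∀ w ∈ W, v * w ∈ W) :
    ∀ w ∈ W, u * w ∈ W := by
  intro w hw
  let m : W →ₗ[ℂ] W := (LinearMap.mulLeft ℂ v).restrict h
  have hinj : Function.Injective m := by
    intro x y hxy
    have h' : u * (v * x.1) = u * (v * y.1) := congrArg (fun z : W => u * z.1) hxy
    rw [← mul_assoc, ← mul_assoc, huv, one_mul, one_mul] at h'
    exact Subtype.ext h'
  obtain ⟨z, hz⟩ := LinearMap.surjective_of_injective hinj ⟨w, hw⟩
  have hz' : v * z.1 = w := congrArg Subtype.val hz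
  rw [← hz', ← mul_assoc, huv, one_mul]
  exact z.2

/-- Multiplication by the invertible element `V` is a bijection of the finite-dimensional
algebra `Ŝ ⊗ S`, so this algebra contains `1` and `V* = V⁻¹`. -/
theorem one_mem_and_opStar_mem (V : MultiplicativeUnitary H) :
    (1 : Module.End ℂ (H ⊗[ℂ] H)) ∈ tensorSpan V.spaceSHat V.spaceS ∧
      V.opStar ∈ tensorSpan V.spaceSHat V.spaceS := by
  have hmul := fun T hT => tensorSpan_mul V.spaceSHat_mul V.spaceS_mul (T := T) V.op_mem hT
  have hsurj : ∀ w ∈ tensorSpan V.spaceSHat V.spaceS,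
      V.opStar * w ∈ tensorSpan V.spaceSHat V.spaceS :=
    mem_of_mul_mem _ V.opStar_mul_op hmul
  have h1 : (1 : Module.End ℂ (H ⊗[ℂ] H)) ∈ tensorSpan V.spaceSHat V.spaceS := by
    have := hsurj _ V.op_mem
    rwa [opStar_mul_op] at this
  refine ⟨h1, ?_⟩
  have := hsurj _ h1
  rwa [mul_one] at this

theorem exists_dual_one (H : Type*) [NormedAddCommGroup H] [InnerProductSpace ℂ H]
    [FiniteDimensional ℂ H] :
    ∃ ω : Module.Dual ℂ (Module.End ℂ H), ω 1 • (1 : Module.End ℂ H) = 1 := by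
  by_cases h : (1 : Module.End ℂ H) = 0
  · exact ⟨0, by simp [h]⟩
  · obtain ⟨ω, hω⟩ := Module.Projective.exists_dual_eq_one ℂ h
    exact ⟨ω, by rw [hω, one_smul]⟩

theorem one_mem_spaceS (V : MultiplicativeUnitary H) : (1 : Module.End ℂ H) ∈ V.spaceS := by
  obtain ⟨ω, hω⟩ := exists_dual_one H
  have := sliceLeft_mem V.one_mem_and_opStar_mem.1 ω
  rwa [← TensorProduct.map_one, sliceLeft_map, hω] at this

theorem one_mem_spaceSHat (V : MultiplicativeUnitary H) :
    (1 : Module.End ℂ H) ∈ V.spaceSHat := by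
  obtain ⟨ω, hω⟩ := exists_dual_one H
  have := sliceRight_mem V.one_mem_and_opStar_mem.1 ω
  rwa [← TensorProduct.map_one, sliceRight_map, hω] at this

/-- The unital involutive algebra `S = {L(ω) : ω ∈ L(H)*}`; its involution is the adjoint. -/
def S (V : MultiplicativeUnitary H) : StarSubalgebra ℂ (Module.End ℂ H) where
  carrier := Set.range V.L
  add_mem' := V.spaceS.add_mem
  zero_mem' := V.spaceS.zero_mem
  mul_mem' := fun {a b} ha hb => V.spaceS_mul a ha b hb
  one_mem' := V.one_mem_spaceS
  algebraMap_mem' := fun r => by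
    rw [Algebra.algebraMap_eq_smul_one]
    exact V.spaceS.smul_mem r V.one_mem_spaceS
  star_mem' := by
    rintro _ ⟨ω, rfl⟩
    have h := adjoint_sliceLeft ω V.op
    have h' := sliceLeft_mem V.one_mem_and_opStar_mem.2 (dualStar ω)
    rw [opStar, ← h] at h'
    exact h'

/-- The unital involutive algebra `Ŝ = {ρ(ω) : ω ∈ L(H)*}`; its involution is the adjoint. -/
def SHat (V : MultiplicativeUnitary H) : StarSubalgebra ℂ (Module.End ℂ H) where
  carrier := Set.range V.rho
  add_mem' := V.spaceSHat.add_mem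
  zero_mem' := V.spaceSHat.zero_mem
  mul_mem' := fun {a b} ha hb => V.spaceSHat_mul a ha b hb
  one_mem' := V.one_mem_spaceSHat
  algebraMap_mem' := fun r => by
    rw [Algebra.algebraMap_eq_smul_one]
    exact V.spaceSHat.smul_mem r V.one_mem_spaceSHat
  star_mem' := by
    rintro _ ⟨ω, rfl⟩
    have h := adjoint_sliceRight ω V.op
    have h' := sliceRight_mem V.one_mem_and_opStar_mem.2 (dualStar ω)
    rw [opStar, ← h] at h'
    exact h'

/-- The coproduct `δ(x) = V (x ⊗ 1) V*` of `S`, as a map defined on all of `L(H)`. -/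
def comul (V : MultiplicativeUnitary H) (x : Module.End ℂ H) : Module.End ℂ (H ⊗[ℂ] H) :=
  V.op * TensorProduct.map x (1 : Module.End ℂ H) * V.opStar

/-- The coproduct `δ̂(x) = V* (1 ⊗ x) V` of `Ŝ`, as a map defined on all of `L(H)`. -/
def comulHat (V : MultiplicativeUnitary H) (x : Module.End ℂ H) : Module.End ℂ (H ⊗[ℂ] H) :=
  V.opStar * TensorProduct.map (1 : Module.End ℂ H) x * V.op

/-- A right coideal subalgebra of `S`: a unital subalgebra `B` of `S` with `δ(B) ⊆ B ⊗ S`. -/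
def IsRightCoideal (V : MultiplicativeUnitary H) (B : Subalgebra ℂ (Module.End ℂ H)) : Prop :=
  B ≤ V.S.toSubalgebra ∧
    ∀ x ∈ B, V.comul x ∈
      tensorSpan (Subalgebra.toSubmodule B) (Subalgebra.toSubmodule V.S.toSubalgebra)

/-- A left coideal subalgebra of `S`: a unital subalgebra `B` of `S` with `δ(B) ⊆ S ⊗ B`. -/
def IsLeftCoideal (V : MultiplicativeUnitary H) (B : Subalgebra ℂ (Module.End ℂ H)) : Prop :=
  B ≤ V.S.toSubalgebra ∧
    ∀ x ∈ B, V.comul x ∈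
      tensorSpan (Subalgebra.toSubmodule V.S.toSubalgebra) (Subalgebra.toSubmodule B)

/-- A right coideal subalgebra of `Ŝ`: a unital subalgebra `B` of `Ŝ` with `δ̂(B) ⊆ B ⊗ Ŝ`. -/
def IsRightCoidealHat (V : MultiplicativeUnitary H) (B : Subalgebra ℂ (Module.End ℂ H)) : Prop :=
  B ≤ V.SHat.toSubalgebra ∧
    ∀ x ∈ B, V.comulHat x ∈
      tensorSpan (Subalgebra.toSubmodule B) (Subalgebra.toSubmodule V.SHat.toSubalgebra)

/-- A left coideal subalgebra of `Ŝ`: a unital subalgebra `B` of `Ŝ` with `δ̂(B) ⊆ Ŝ ⊗ B`. -/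
def IsLeftCoidealHat (V : MultiplicativeUnitary H) (B : Subalgebra ℂ (Module.End ℂ H)) : Prop :=
  B ≤ V.SHat.toSubalgebra ∧
    ∀ x ∈ B, V.comulHat x ∈
      tensorSpan (Subalgebra.toSubmodule V.SHat.toSubalgebra) (Subalgebra.toSubmodule B)

/-- The space of fixed vectors: `V(ξ ⊗ η) = ξ ⊗ η` for every `η`. -/
def fixedSpace (V : MultiplicativeUnitary H) : Submodule ℂ H where
  carrier := {ξ | ∀ η : H, V.op (ξ ⊗ₜ[ℂ] η) = ξ ⊗ₜ[ℂ] η}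
  add_mem' ha hb η := by rw [TensorProduct.add_tmul, map_add, ha η, hb η]
  zero_mem' η := by rw [TensorProduct.zero_tmul, map_zero]
  smul_mem' r ξ h η := by rw [← TensorProduct.smul_tmul', map_smul, h η]

/-- The multiplicity of `V`: the dimension of the space of fixed vectors. -/
def multiplicity (V : MultiplicativeUnitary H) : ℕ := Module.finrank ℂ V.fixedSpace

/-- `ξ` is cofixed: `V(η ⊗ ξ) = η ⊗ ξ` for every `η`. -/
def IsCofixed (V : MultiplicativeUnitary H) (ξ : H) : Prop :=
  ∀ η : H, V.op (η ⊗ₜ[ℂ] ξ) = η ⊗ₜ[ℂ] ξ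

/-- `H_ξ = {η : V(η ⊗ ξ) = η ⊗ ξ}`. -/
def lowerSpace (V : MultiplicativeUnitary H) (ξ : H) : Submodule ℂ H where
  carrier := {η | V.op (η ⊗ₜ[ℂ] ξ) = η ⊗ₜ[ℂ] ξ}
  add_mem' {a b} ha hb := by
    change V.op (a ⊗ₜ[ℂ] ξ) = a ⊗ₜ[ℂ] ξ at ha
    change V.op (b ⊗ₜ[ℂ] ξ) = b ⊗ₜ[ℂ] ξ at hb
    change V.op ((a + b) ⊗ₜ[ℂ] ξ) = (a + b) ⊗ₜ[ℂ] ξ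
    rw [TensorProduct.add_tmul, map_add, ha, hb]
  zero_mem' := by
    change V.op ((0 : H) ⊗ₜ[ℂ] ξ) = (0 : H) ⊗ₜ[ℂ] ξ
    rw [TensorProduct.zero_tmul, map_zero]
  smul_mem' r a ha := by
    change V.op (a ⊗ₜ[ℂ] ξ) = a ⊗ₜ[ℂ] ξ at ha
    change V.op ((r • a) ⊗ₜ[ℂ] ξ) = (r • a) ⊗ₜ[ℂ] ξ
    rw [← TensorProduct.smul_tmul', map_smul, ha]

/-- `H^ξ = {η : V(ξ ⊗ η) = ξ ⊗ η}`. -/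
def upperSpace (V : MultiplicativeUnitary H) (ξ : H) : Submodule ℂ H where
  carrier := {η | V.op (ξ ⊗ₜ[ℂ] η) = ξ ⊗ₜ[ℂ] η}
  add_mem' {a b} ha hb := by
    change V.op (ξ ⊗ₜ[ℂ] a) = ξ ⊗ₜ[ℂ] a at ha
    change V.op (ξ ⊗ₜ[ℂ] b) = ξ ⊗ₜ[ℂ] b at hb
    change V.op (ξ ⊗ₜ[ℂ] (a + b)) = ξ ⊗ₜ[ℂ] (a + b)
    rw [TensorProduct.tmul_add, map_add, ha, hb]
  zero_mem' := by
    change V.op (ξ ⊗ₜ[ℂ] (0 : H)) = ξ ⊗ₜ[ℂ] (0 : H)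
    rw [TensorProduct.tmul_zero, map_zero]
  smul_mem' r a ha := by
    change V.op (ξ ⊗ₜ[ℂ] a) = ξ ⊗ₜ[ℂ] a at ha
    change V.op (ξ ⊗ₜ[ℂ] (r • a)) = ξ ⊗ₜ[ℂ] (r • a)
    rw [TensorProduct.tmul_smul, map_smul, ha]

/-- The set of pre-subgroups of `V`, for a chosen fixed unit vector `e`: the unit vectors `f` such
that `⟨f, e⟩` is a (strictly) positive real number and `V(f ⊗ f) = f ⊗ f`. -/
def preSubgroups (V : MultiplicativeUnitary H) (e : H) : Set H :=
  {f | ‖f‖ = 1 ∧ (0 < (inner ℂ f e).re ∧ (inner ℂ f e).im = 0) ∧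
    V.op (f ⊗ₜ[ℂ] f) = f ⊗ₜ[ℂ] f}

/-- `U` is the map `x e ↦ κ(x) e` (`x ∈ S`), where `κ` is the antipode
`L(ω) ↦ (ω ⊗ id)(V*)` of `S`. -/
def IsAntipodeUnitary (V : MultiplicativeUnitary H) (e : H) (U : H ≃ₗᵢ[ℂ] H) : Prop :=
  ∀ ω : Module.Dual ℂ (Module.End ℂ H), U (V.L ω e) = sliceLeft ω V.opStar e

/-- `G_f = {x ∈ S : x e ∈ H_f}`. -/
def G (V : MultiplicativeUnitary H) (e f : H) : Submodule ℂ (Module.End ℂ H) :=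
  Subalgebra.toSubmodule V.S.toSubalgebra ⊓
    (V.lowerSpace f).comap (LinearMap.applyₗ e : Module.End ℂ H →ₗ[ℂ] H)

/-- `D_f = {x ∈ S : x e ∈ U H_f}`. -/
def D (V : MultiplicativeUnitary H) (e : H) (U : H ≃ₗᵢ[ℂ] H) (f : H) :
    Submodule ℂ (Module.End ℂ H) :=
  Subalgebra.toSubmodule V.S.toSubalgebra ⊓
    ((V.lowerSpace f).map (U.toLinearEquiv : H →ₗ[ℂ] H)).comap
      (LinearMap.applyₗ e : Module.End ℂ H →ₗ[ℂ] H)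

/-- `D̂_f = {x ∈ Ŝ : x ê ∈ H^f}`. -/
def DHat (V : MultiplicativeUnitary H) (e' f : H) : Submodule ℂ (Module.End ℂ H) :=
  Subalgebra.toSubmodule V.SHat.toSubalgebra ⊓
    (V.upperSpace f).comap (LinearMap.applyₗ e' : Module.End ℂ H →ₗ[ℂ] H)

/-- `Ĝ_f = {x ∈ Ŝ : x ê ∈ U H^f}`. -/
def GHat (V : MultiplicativeUnitary H) (e' : H) (U : H ≃ₗᵢ[ℂ] H) (f : H) :
    Submodule ℂ (Module.End ℂ H) :=
  Subalgebra.toSubmodule V.SHat.toSubalgebra ⊓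
    ((V.upperSpace f).map (U.toLinearEquiv : H →ₗ[ℂ] H)).comap
      (LinearMap.applyₗ e' : Module.End ℂ H →ₗ[ℂ] H)

end MultiplicativeUnitary

end

/-! Everything is read off from vectors. The normalized partial trace `haar` of `V` is a contractive
idempotent, hence the orthogonal projection onto the fixed vectors, and invariance of the trace
gives `Tr x = n ⟨e, x e⟩` on `S`. So `e` is separating for `S`; multiplicity one makes it cyclic.
Thus `x ↦ x e` identifies `S` with `H`, with inverse `ofVec : ξ ↦ n^(1/2) L(ω_{ê,ξ})`. The dual
unitary `Σ V* Σ` exchanges `S` and `Ŝ`, `e` and `ê`, `H_f` and `H^f`, so it is enough to treat `S`.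

As the vector state of `e` is tracial, `J : x e ↦ x* e` is antiunitary on `H`; let `Ĵ` be its dual.
They commute, `J` normalizes `Ŝ`, `Ĵ` normalizes `S`, and `U = J Ĵ` implements the antipode `κ(x) =
Ĵ x* Ĵ`. On vectors, a subspace `B` of `S` is a right coideal iff `B e` is stable under `Ŝ`
(`rightCoideal_iff`), and a left coideal iff `B e` is stable under `Ĵ Ŝ Ĵ`, which commutes with `Ŝ`
(`leftCoideal_iff`, `modConj_conj_comm`).

For a pre-subgroup `f`, `p_f = ρ(ω_{f,f})` lies in `Ŝ` and is the orthogonal projection onto `H_f`.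
It commutes with `Ĵ Ŝ Ĵ`, so `G_f` is a left coideal. The identity `n^(-1/2) f = ⟨e, f⟩ p_f ê`
(`smul_eq_smul_lowerProj`) shows that `H_f` determines `f`.

Conversely, given a left coideal subalgebra `B`, let `f₀` be the projection of `ê` onto `B e`. On
`B` the form `ω_{f₀,f₀}` is `‖f₀‖²` times the counit, and the equality case of Cauchy–Schwarz yields
`V(x e ⊗ f₀) = x e ⊗ f₀` for `x ∈ B`. Hence `f = f₀/‖f₀‖` is a pre-subgroup with `B e ⊆ H_f`;
stability of `B e` under `Ĵ Ŝ Ĵ` gives equality (`exists_preSubgroup_of_isLeftCoideal`). Nowhere is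
`B` assumed involutive: `J` commutes with `p_f`, so `B e = H_f` is `J`-stable and `B` is
automatically closed under the involution. Right coideals follow by applying `κ`. -/

noncomputable section

/-! ### Vector forms, slices, and elementary operator theory. -/

namespace MultUnitary

variable {H : Type*} [NormedAddCommGroup H] [InnerProductSpace ℂ H] [FiniteDimensional ℂ H]

/-- The vector form `T ↦ ⟨ξ, T η⟩` on `L(H)`. -/
def vecForm (ξ η : H) : Module.Dual ℂ (Module.End ℂ H) :=
  (innerSL ℂ ξ).toLinearMap ∘ₗ LinearMap.applyₗ η

@[simp]
theorem vecForm_apply (ξ η : H) (T : Module.End ℂ H) : vecForm ξ η T = inner ℂ ξ (T η) := rfl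

theorem inner_sliceLeft (ξ η ζ θ : H) (T : Module.End ℂ (H ⊗[ℂ] H)) :
    inner ℂ ζ (sliceLeft (vecForm ξ η) T θ) = inner ℂ (ξ ⊗ₜ[ℂ] ζ) (T (η ⊗ₜ[ℂ] θ)) := by
  induction T using end_induction
  · simp
  · simp [sliceLeft_map]
  · rename_i x y hx hy
    simp [inner_add_right, hx, hy]

theorem inner_sliceRight (ξ η ζ θ : H) (T : Module.End ℂ (H ⊗[ℂ] H)) :
    inner ℂ ζ (sliceRight (vecForm ξ η) T θ) = inner ℂ (ζ ⊗ₜ[ℂ] ξ) (T (θ ⊗ₜ[ℂ] η)) := by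
  induction T using end_induction
  · simp
  · simp [sliceRight_map, mul_comm]
  · rename_i x y hx hy
    simp [inner_add_right, hx, hy]

theorem apply_sliceLeft (ω ω' : Module.Dual ℂ (Module.End ℂ H)) (T : Module.End ℂ (H ⊗[ℂ] H)) :
    ω' (sliceLeft ω T) = ω (sliceRight ω' T) := by
  induction T using end_induction
  · simp
  · simp [sliceLeft_map, sliceRight_map, mul_comm]
  · rename_i x y hx hy
    simp [hx, hy]

theorem end_ext_inner {S T : Module.End ℂ H} (h : ∀ ξ η, inner ℂ ξ (S η) = inner ℂ ξ (T η)) :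
    S = T :=
  LinearMap.ext fun η => ext_inner_left ℂ fun ξ => h ξ η

theorem end_ext_dual {S T : Module.End ℂ H}
    (h : ∀ ω : Module.Dual ℂ (Module.End ℂ H), ω S = ω T) : S = T :=
  end_ext_inner fun ξ η => h (vecForm ξ η)

theorem trace_sliceLeft (T : Module.End ℂ (H ⊗[ℂ] H)) :
    LinearMap.trace ℂ H (sliceLeft (LinearMap.trace ℂ H) T) = LinearMap.trace ℂ (H ⊗[ℂ] H) T := by
  induction T using end_induction
  · simp
  · simp [sliceLeft_map, LinearMap.trace_tensorProduct']
  · rename_i x y hx hy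
    simp [hx, hy]

theorem sliceLeft_congr {P Q : Submodule ℂ (Module.End ℂ H)} {T : Module.End ℂ (H ⊗[ℂ] H)}
    (hT : T ∈ tensorSpan P Q) {ω ω' : Module.Dual ℂ (Module.End ℂ H)}
    (h : ∀ x ∈ P, ω x = ω' x) : sliceLeft ω T = sliceLeft ω' T := by
  refine (Submodule.span_le.2 ?_ :
    tensorSpan P Q ≤ LinearMap.eqLocus (sliceLeft ω) (sliceLeft ω')) hT
  rintro _ ⟨a, ha, b, -, rfl⟩
  simp [LinearMap.mem_eqLocus, sliceLeft_map, h a ha]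

theorem sliceRight_congr {P Q : Submodule ℂ (Module.End ℂ H)} {T : Module.End ℂ (H ⊗[ℂ] H)}
    (hT : T ∈ tensorSpan P Q) {ω ω' : Module.Dual ℂ (Module.End ℂ H)}
    (h : ∀ x ∈ Q, ω x = ω' x) : sliceRight ω T = sliceRight ω' T := by
  refine (Submodule.span_le.2 ?_ :
    tensorSpan P Q ≤ LinearMap.eqLocus (sliceRight ω) (sliceRight ω')) hT
  rintro _ ⟨a, -, b, hb, rfl⟩
  simp [LinearMap.mem_eqLocus, sliceRight_map, h b hb]

/-- Conjugating `T₁₂` on legs 2 and 3 acts on the second leg of `T` alone, by `a ↦ X (a ⊗ 1) Y`.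
With `X = V` and `Y = V*` this is the coproduct. -/
theorem apply_slices_conj (ω ω₁ ω₂ : Module.Dual ℂ (Module.End ℂ H))
    (X Y T : Module.End ℂ (H ⊗[ℂ] H)) :
    ω (sliceRight ω₁ (sliceRight ω₂ (leg23 X * leg12 T * leg23 Y))) =
      dualTensor ω₁ ω₂ (X * TensorProduct.map (sliceLeft ω T) 1 * Y) := by
  induction T using end_induction
  · simp [TensorProduct.map_zero_left]
  · rename_i a b
    rw [leg12_apply, sliceLeft_map]
    induction X using end_induction
    · simp
    · rename_i p q
      induction Y using end_induction
      · simp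
      · rename_i r s
        rw [leg23_map, leg23_map]
        simp only [← TensorProduct.map_mul, sliceRight_map, map_smul, dualTensor,
          LinearMap.comp_apply, sliceLeft_map, TensorProduct.map_smul_left, mul_smul_comm,
          smul_mul_assoc, smul_eq_mul, one_mul, mul_one]
        ring
      · rename_i x y hx hy
        simp only [map_add, mul_add, hx, hy]
    · rename_i x y hx hy
      simp only [map_add, add_mul, hx, hy]
  · rename_i x y hx hy
    simp only [map_add, mul_add, add_mul, hx, hy, TensorProduct.map_add_left]

/-- A contractive idempotent of a Hilbert space is self-adjoint. -/
theorem adjoint_eq_of_idempotent_contraction {T : Module.End ℂ H} (hT : T * T = T)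
    (hn : ∀ x, ‖T x‖ ≤ ‖x‖) : LinearMap.adjoint T = T := by
  have key : ∀ x y, inner ℂ (x - T x) (T y) = 0 := by
    intro x y
    have hTT : ∀ z, T (T z) = T z := fun z => LinearMap.congr_fun hT z
    set k := x - T x with hk
    set r := T y with hr
    have hTk : T k = 0 := by rw [hk, map_sub, hTT, sub_self]
    have hTr : T r = r := hTT y
    set z : ℂ := inner ℂ k r with hz
    -- Perturb `r` in the range of `T` by a small multiple of `k` in its kernel: contractivity
    -- forbids a decrease of the norm. This `s` satisfies `s ‖k‖² < 2`, also when `k = 0`, so a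
    -- nonzero `⟨k, r⟩` would decrease it.
    set s : ℝ := (‖k‖ ^ 2 + 1)⁻¹ with hs
    have h1 : ‖r‖ ≤ ‖r - ((s : ℂ) * z) • k‖ := by
      have := hn (r - ((s : ℂ) * z) • k)
      rwa [map_sub, map_smul, hTk, smul_zero, sub_zero, hTr] at this
    have h2 : ‖r - ((s : ℂ) * z) • k‖ ^ 2 =
        ‖r‖ ^ 2 - 2 * (s * ‖z‖ ^ 2) + s ^ 2 * ‖z‖ ^ 2 * ‖k‖ ^ 2 := by
      rw [@norm_sub_sq ℂ, inner_smul_right, ← inner_conj_symm r k, ← hz, norm_smul, norm_mul,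
        mul_assoc, Complex.mul_conj]
      simp only [Complex.normSq_eq_norm_sq, Complex.norm_real, mul_pow, Real.norm_eq_abs, sq_abs]
      norm_cast
    have h3 : ‖r‖ ^ 2 ≤ ‖r - ((s : ℂ) * z) • k‖ ^ 2 := by gcongr
    have hs0 : 0 < s := by positivity
    have hsk : s * ‖k‖ ^ 2 ≤ 1 := by
      rw [hs, inv_mul_le_iff₀ (by positivity)]; linarith
    have h4 : s * ‖z‖ ^ 2 ≤ 0 := by
      have h5 : 0 ≤ (s * ‖z‖ ^ 2) * (s * ‖k‖ ^ 2 - 2) := by rw [h2] at h3; linarith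
      by_contra hcon
      push Not at hcon
      have := mul_neg_of_pos_of_neg hcon (by linarith : s * ‖k‖ ^ 2 - 2 < 0)
      linarith
    have h6 : ‖z‖ ^ 2 ≤ 0 := by
      by_contra hcon
      push Not at hcon
      have := mul_pos hs0 hcon
      linarith
    have : ‖z‖ = 0 := by nlinarith [norm_nonneg z, sq_nonneg ‖z‖]
    exact norm_eq_zero.1 this
  have h' : ∀ x y, inner ℂ x (T y) = inner ℂ (T x) (T y) := fun x y => by
    have := key x y
    rwa [inner_sub_left, sub_eq_zero] at this
  symm
  rw [LinearMap.eq_adjoint_iff]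
  intro x y
  rw [h' x y, ← inner_conj_symm, h' y x, inner_conj_symm]

theorem sum_inner_eq_zero_imp {ι : Type*} [Fintype ι] (b : OrthonormalBasis ι ℂ H)
    {T : Module.End ℂ H} (h : ∑ i, inner ℂ (T (b i)) (T (b i)) = (0 : ℂ)) : T = 0 := by
  refine b.toBasis.ext fun i => ?_
  have h1 : ∑ i, ‖T (b i)‖ ^ 2 = 0 := by
    simp only [inner_self_eq_norm_sq_to_K] at h
    exact Complex.ofReal_injective (by push_cast; exact h)
  have := (Finset.sum_eq_zero_iff_of_nonneg (fun i _ => by positivity)).1 h1 i (Finset.mem_univ i)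
  simpa using this

theorem eq_zero_of_trace_adjoint_mul {T : Module.End ℂ H}
    (h : LinearMap.trace ℂ H (LinearMap.adjoint T * T) = 0) : T = 0 := by
  refine sum_inner_eq_zero_imp (stdOrthonormalBasis ℂ H) ?_
  rw [LinearMap.trace_eq_sum_inner _ (stdOrthonormalBasis ℂ H)] at h
  simpa [LinearMap.adjoint_inner_right] using h

end MultUnitary

/-! ### The coproduct of `S` through slices of `V`. -/

namespace MultiplicativeUnitary

open MultUnitary

variable {H : Type*} [NormedAddCommGroup H] [InnerProductSpace ℂ H] [FiniteDimensional ℂ H]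

theorem op_opStar_apply (V : MultiplicativeUnitary H) (x : H ⊗[ℂ] H) : V.op (V.opStar x) = x :=
  LinearMap.congr_fun V.op_mul_opStar x

theorem opStar_op_apply (V : MultiplicativeUnitary H) (x : H ⊗[ℂ] H) : V.opStar (V.op x) = x :=
  LinearMap.congr_fun V.opStar_mul_op x

theorem inner_opStar_right (V : MultiplicativeUnitary H) (x y : H ⊗[ℂ] H) :
    inner ℂ x (V.opStar y) = inner ℂ (V.op x) y := LinearMap.adjoint_inner_right _ _ _

theorem inner_opStar_left (V : MultiplicativeUnitary H) (x y : H ⊗[ℂ] H) :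
    inner ℂ (V.opStar x) y = inner ℂ x (V.op y) := LinearMap.adjoint_inner_left _ _ _

theorem norm_op (V : MultiplicativeUnitary H) (x : H ⊗[ℂ] H) : ‖V.op x‖ = ‖x‖ :=
  V.unitary.norm_map x

theorem opStar_eq_self (V : MultiplicativeUnitary H) {x : H ⊗[ℂ] H} (h : V.op x = x) :
    V.opStar x = x := by
  conv_lhs => rw [← h]
  exact V.opStar_op_apply x

/-- The equality case of the Cauchy-Schwarz inequality for the unitary `V`. -/
theorem op_eq_self_of_inner (V : MultiplicativeUnitary H) {x : H ⊗[ℂ] H}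
    (h : (inner ℂ x (V.op x)).re = ‖x‖ ^ 2) : V.op x = x := by
  have h1 : ‖x - V.op x‖ ^ 2 = 0 := by
    rw [@norm_sub_sq ℂ, norm_op]
    change ‖x‖ ^ 2 - 2 * (inner ℂ x (V.op x)).re + ‖x‖ ^ 2 = 0
    rw [h]; ring
  have h2 : x - V.op x = 0 := by simpa using h1
  exact (sub_eq_zero.1 h2).symm

theorem inner_L (V : MultiplicativeUnitary H) (ξ η ζ θ : H) :
    inner ℂ ζ (V.L (vecForm ξ η) θ) = inner ℂ (ξ ⊗ₜ[ℂ] ζ) (V.op (η ⊗ₜ[ℂ] θ)) :=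
  inner_sliceLeft _ _ _ _ _

theorem inner_rho (V : MultiplicativeUnitary H) (ξ η ζ θ : H) :
    inner ℂ ζ (V.rho (vecForm ξ η) θ) = inner ℂ (ζ ⊗ₜ[ℂ] ξ) (V.op (θ ⊗ₜ[ℂ] η)) :=
  inner_sliceRight _ _ _ _ _

theorem apply_L (V : MultiplicativeUnitary H) (ω ω' : Module.Dual ℂ (Module.End ℂ H)) :
    ω' (V.L ω) = ω (V.rho ω') := apply_sliceLeft _ _ _

theorem L_mem (V : MultiplicativeUnitary H) (ω) : V.L ω ∈ V.spaceS := ⟨ω, rfl⟩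

theorem rho_mem (V : MultiplicativeUnitary H) (ω) : V.rho ω ∈ V.spaceSHat := ⟨ω, rfl⟩

theorem adjoint_mem_spaceS (V : MultiplicativeUnitary H) {x : Module.End ℂ H}
    (hx : x ∈ V.spaceS) : LinearMap.adjoint x ∈ V.spaceS := V.S.star_mem' hx

/-- `(id ⊗ δ)(V) = V₁₂ V₁₃`, evaluated on forms. -/
theorem apply_rho_mul_rho (V : MultiplicativeUnitary H)
    (ω ω₁ ω₂ : Module.Dual ℂ (Module.End ℂ H)) :
    ω (V.rho ω₁ * V.rho ω₂) = dualTensor ω₁ ω₂ (V.comul (V.L ω)) := by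
  have h : leg12 V.op * leg13 V.op = leg23 V.op * leg12 V.op * leg23 V.opStar := by
    have hp : leg12 V.op * leg13 V.op * leg23 V.op = leg23 V.op * leg12 V.op := V.pentagon
    have h1 : leg23 V.op * leg23 V.opStar = 1 := by
      rw [← leg23_mul, op_mul_opStar, ← TensorProduct.map_one, leg23_map]
      simp
    rw [← hp, mul_assoc, h1, mul_one]
  rw [comul, L, ← apply_slices_conj, ← h, slice_leg12_mul_leg13]
  rfl

/-- By `apply_rho_mul_rho`, both kinds of slices of `δ(L(ω))` are again of the form `L(ψ)`, with `ψ`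
obtained from `ω` by left or right multiplication by an element of `Ŝ`. -/
theorem comul_mem (V : MultiplicativeUnitary H) {x : Module.End ℂ H} (hx : x ∈ V.spaceS) :
    V.comul x ∈ tensorSpan V.spaceS V.spaceS := by
  obtain ⟨ω, rfl⟩ := hx
  refine mem_tensorSpan _ (fun ω₁ => ?_) (fun ω₂ => ?_)
  · refine ⟨ω ∘ₗ LinearMap.mulLeft ℂ (V.rho ω₁), end_ext_dual fun ω₂ => ?_⟩
    rw [apply_L]
    exact V.apply_rho_mul_rho ω ω₁ ω₂
  · refine ⟨ω ∘ₗ LinearMap.mulRight ℂ (V.rho ω₂), end_ext_dual fun ω₁ => ?_⟩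
    rw [apply_L, ← apply_sliceLeft]
    exact V.apply_rho_mul_rho ω ω₁ ω₂

theorem comul_adjoint (V : MultiplicativeUnitary H) (x : Module.End ℂ H) :
    V.comul (LinearMap.adjoint x) = LinearMap.adjoint (V.comul x) := by
  have h1 : LinearMap.adjoint V.opStar = V.op := LinearMap.adjoint_adjoint _
  have h2 : LinearMap.adjoint (1 : Module.End ℂ H) = 1 := LinearMap.adjoint_id
  simp only [comul, Module.End.mul_eq_comp, LinearMap.adjoint_comp, TensorProduct.adjoint_map, h1,
    h2, LinearMap.comp_assoc]
  rfl

end MultiplicativeUnitary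

/-! ### The flip of the tensor factors. -/

namespace MultUnitary

variable {H : Type*} [NormedAddCommGroup H] [InnerProductSpace ℂ H] [FiniteDimensional ℂ H]

/-- `T ↦ Σ T Σ`, where `Σ` exchanges the two factors of `H ⊗ H`. -/
def flipEnd : Module.End ℂ (H ⊗[ℂ] H) →ₗ[ℂ] Module.End ℂ (H ⊗[ℂ] H) :=
  (TensorProduct.comm ℂ H H).conj.toLinearMap

theorem flipEnd_apply (T : Module.End ℂ (H ⊗[ℂ] H)) (x : H ⊗[ℂ] H) :
    flipEnd T x = TensorProduct.comm ℂ H H (T (TensorProduct.comm ℂ H H x)) := by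
  simp [flipEnd, LinearEquiv.conj_apply]

theorem flipEnd_map (a b : Module.End ℂ H) :
    flipEnd (TensorProduct.map a b) = TensorProduct.map b a := by
  refine TensorProduct.ext' fun x y => ?_
  simp [flipEnd_apply]

theorem flipEnd_flipEnd (T : Module.End ℂ (H ⊗[ℂ] H)) : flipEnd (flipEnd T) = T := by
  refine LinearMap.ext fun x => ?_
  simp [flipEnd_apply]

theorem flipEnd_mul (S T : Module.End ℂ (H ⊗[ℂ] H)) :
    flipEnd (S * T) = flipEnd S * flipEnd T := by
  refine LinearMap.ext fun x => ?_
  simp [flipEnd_apply]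

theorem sliceLeft_flipEnd (ω : Module.Dual ℂ (Module.End ℂ H)) (T : Module.End ℂ (H ⊗[ℂ] H)) :
    sliceLeft ω (flipEnd T) = sliceRight ω T := by
  induction T using end_induction
  · simp
  · simp [flipEnd_map, sliceLeft_map, sliceRight_map]
  · rename_i x y hx hy
    simp [hx, hy]

theorem sliceRight_flipEnd (ω : Module.Dual ℂ (Module.End ℂ H)) (T : Module.End ℂ (H ⊗[ℂ] H)) :
    sliceRight ω (flipEnd T) = sliceLeft ω T := by
  rw [← sliceLeft_flipEnd, flipEnd_flipEnd]

theorem flipEnd_mem_tensorSpan {P Q : Submodule ℂ (Module.End ℂ H)}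
    {T : Module.End ℂ (H ⊗[ℂ] H)} : flipEnd T ∈ tensorSpan P Q ↔ T ∈ tensorSpan Q P := by
  have key : ∀ (P Q : Submodule ℂ (Module.End ℂ H)) (T : Module.End ℂ (H ⊗[ℂ] H)),
      T ∈ tensorSpan Q P → flipEnd T ∈ tensorSpan P Q := by
    intro P Q T hT
    refine (Submodule.span_le.2 ?_ :
      tensorSpan Q P ≤ (tensorSpan P Q).comap (flipEnd (H := H))) hT
    rintro _ ⟨a, ha, b, hb, rfl⟩
    change flipEnd (TensorProduct.map a b) ∈ tensorSpan P Q
    rw [flipEnd_map]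
    exact Submodule.subset_span ⟨b, hb, a, ha, rfl⟩
  refine ⟨fun h => ?_, key P Q T⟩
  rw [← flipEnd_flipEnd T]
  exact key Q P (flipEnd T) h

/-- The flip `x ⊗ y ⊗ z ↦ z ⊗ y ⊗ x` of `H ⊗ H ⊗ H`. -/
def revEquiv (H : Type*) [NormedAddCommGroup H] [InnerProductSpace ℂ H] [FiniteDimensional ℂ H] :
    ((H ⊗[ℂ] H) ⊗[ℂ] H) ≃ₗ[ℂ] ((H ⊗[ℂ] H) ⊗[ℂ] H) :=
  TensorProduct.comm ℂ (H ⊗[ℂ] H) H ≪≫ₗ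
    TensorProduct.congr (LinearEquiv.refl ℂ H) (TensorProduct.comm ℂ H H) ≪≫ₗ
    (TensorProduct.assoc ℂ H H H).symm

theorem conj_mul_end {M N : Type*} [AddCommGroup M] [Module ℂ M] [AddCommGroup N] [Module ℂ N]
    (u : M ≃ₗ[ℂ] N) (S T : Module.End ℂ M) : u.conj (S * T) = u.conj S * u.conj T :=
  u.conj_comp T S

theorem revEquiv_conj_map (a b c : Module.End ℂ H) :
    (revEquiv H).conj (TensorProduct.map (TensorProduct.map a b) c) =
      TensorProduct.map (TensorProduct.map c b) a := by
  refine TensorProduct.ext_threefold fun x y z => ?_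
  simp [revEquiv, LinearEquiv.conj_apply]

/-- Reversing the three factors exchanges legs 12 and 23 up to a flip; this turns the adjoint of the
pentagon equation of `V` into the pentagon equation of `Σ V* Σ`. -/
theorem leg12_flipEnd (T : Module.End ℂ (H ⊗[ℂ] H)) :
    leg12 (flipEnd T) = (revEquiv H).conj (leg23 T) := by
  induction T using end_induction
  · simp
  · rw [flipEnd_map, leg12_apply, leg23_map, revEquiv_conj_map]
  · rename_i x y hx hy
    simp only [map_add, hx, hy]

theorem leg23_flipEnd (T : Module.End ℂ (H ⊗[ℂ] H)) :
    leg23 (flipEnd T) = (revEquiv H).conj (leg12 T) := by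
  induction T using end_induction
  · simp
  · rw [flipEnd_map, leg12_apply, leg23_map, revEquiv_conj_map]
  · rename_i x y hx hy
    simp only [map_add, hx, hy]

theorem leg13_flipEnd (T : Module.End ℂ (H ⊗[ℂ] H)) :
    leg13 (flipEnd T) = (revEquiv H).conj (leg13 T) := by
  induction T using end_induction
  · simp
  · rw [flipEnd_map, leg13_map, leg13_map, revEquiv_conj_map]
  · rename_i x y hx hy
    simp only [map_add, hx, hy]

theorem leg12_mul (S T : Module.End ℂ (H ⊗[ℂ] H)) : leg12 (S * T) = leg12 S * leg12 T := by
  rw [leg12_apply, leg12_apply, leg12_apply, ← TensorProduct.map_mul, one_mul]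

theorem leg12_one : leg12 (1 : Module.End ℂ (H ⊗[ℂ] H)) = 1 := by
  rw [leg12_apply, TensorProduct.map_one]

theorem leg23_one : leg23 (1 : Module.End ℂ (H ⊗[ℂ] H)) = 1 := by
  rw [← TensorProduct.map_one, leg23_map, TensorProduct.map_one, TensorProduct.map_one]

theorem leg13_one : leg13 (1 : Module.End ℂ (H ⊗[ℂ] H)) = 1 := by
  rw [← TensorProduct.map_one, leg13_map, TensorProduct.map_one, TensorProduct.map_one]

theorem leg13_mul (S T : Module.End ℂ (H ⊗[ℂ] H)) : leg13 (S * T) = leg13 S * leg13 T := by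
  simp only [leg13, LinearMap.comp_apply, LinearEquiv.coe_coe, LinearMap.coe_rTensorHom,
    LinearMap.rTensor_mul, conj_mul_end]

end MultUnitary

/-! ### The dual multiplicative unitary. -/

namespace MultiplicativeUnitary

open MultUnitary

variable {H : Type*} [NormedAddCommGroup H] [InnerProductSpace ℂ H] [FiniteDimensional ℂ H]

theorem pentagon_opStar (V : MultiplicativeUnitary H) :
    leg23 V.opStar * leg13 V.opStar * leg12 V.opStar = leg12 V.opStar * leg23 V.opStar := by
  have h12 : leg12 V.op * leg12 V.opStar = 1 := by rw [← leg12_mul, op_mul_opStar, leg12_one]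
  have h23 : leg23 V.op * leg23 V.opStar = 1 := by rw [← leg23_mul, op_mul_opStar, leg23_one]
  have k12 : leg12 V.opStar * leg12 V.op = 1 := by rw [← leg12_mul, opStar_mul_op, leg12_one]
  have k13 : leg13 V.opStar * leg13 V.op = 1 := by rw [← leg13_mul, opStar_mul_op, leg13_one]
  have k23 : leg23 V.opStar * leg23 V.op = 1 := by rw [← leg23_mul, opStar_mul_op, leg23_one]
  have hp : leg12 V.op * leg13 V.op * leg23 V.op = leg23 V.op * leg12 V.op := V.pentagon
  refine left_inv_eq_right_inv (a := leg23 V.op * leg12 V.op) ?_ ?_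
  · rw [← hp]
    calc _ = leg23 V.opStar * (leg13 V.opStar * (leg12 V.opStar * leg12 V.op) * leg13 V.op) *
          leg23 V.op := by simp only [mul_assoc]
      _ = 1 := by rw [k12, mul_one, k13, mul_one, k23]
  · calc _ = leg23 V.op * (leg12 V.op * leg12 V.opStar) * leg23 V.opStar := by
          simp only [mul_assoc]
      _ = 1 := by rw [h12, mul_one, h23]

/-- The dual multiplicative unitary `Σ V* Σ`. -/
def dual (V : MultiplicativeUnitary H) : MultiplicativeUnitary H where
  unitary := (TensorProduct.commIsometry ℂ H H).trans
    (V.unitary.symm.trans (TensorProduct.commIsometry ℂ H H))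
  pentagon := by
    have h : (((TensorProduct.commIsometry ℂ H H).trans
        (V.unitary.symm.trans (TensorProduct.commIsometry ℂ H H))).toLinearEquiv :
          Module.End ℂ (H ⊗[ℂ] H)) = flipEnd V.opStar := by
      refine LinearMap.ext fun x => ?_
      rw [flipEnd_apply, opStar_eq]
      rfl
    rw [h, leg12_flipEnd, leg13_flipEnd, leg23_flipEnd, ← conj_mul_end,
      ← conj_mul_end, ← conj_mul_end, pentagon_opStar]

theorem dual_op (V : MultiplicativeUnitary H) : V.dual.op = flipEnd V.opStar := by
  refine LinearMap.ext fun x => ?_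
  rw [flipEnd_apply, opStar_eq]
  rfl

theorem dual_opStar (V : MultiplicativeUnitary H) : V.dual.opStar = flipEnd V.op := by
  refine left_inv_eq_right_inv V.dual.opStar_mul_op ?_
  rw [dual_op, ← flipEnd_mul, opStar_mul_op, ← TensorProduct.map_one, flipEnd_map]

theorem dual_dual (V : MultiplicativeUnitary H) : V.dual.dual = V := by
  have h : V.dual.dual.unitary = V.unitary := by
    refine LinearIsometryEquiv.ext fun x => ?_
    have : V.dual.dual.op = V.op := by rw [dual_op, dual_opStar, flipEnd_flipEnd]
    exact LinearMap.congr_fun this x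
  rcases hd : V.dual.dual with ⟨u, p⟩
  rcases V with ⟨u', p'⟩
  rw [hd] at h
  cases h
  rfl

theorem dual_op_tmul (V : MultiplicativeUnitary H) (ξ η : H) :
    V.dual.op (ξ ⊗ₜ[ℂ] η) = TensorProduct.comm ℂ H H (V.opStar (η ⊗ₜ[ℂ] ξ)) := by
  rw [dual_op, flipEnd_apply, TensorProduct.comm_tmul]

theorem dual_opStar_tmul (V : MultiplicativeUnitary H) (ξ η : H) :
    V.dual.opStar (ξ ⊗ₜ[ℂ] η) = TensorProduct.comm ℂ H H (V.op (η ⊗ₜ[ℂ] ξ)) := by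
  rw [dual_opStar, flipEnd_apply, TensorProduct.comm_tmul]

theorem dual_op_tmul_eq_iff (V : MultiplicativeUnitary H) (ξ η : H) :
    V.dual.op (ξ ⊗ₜ[ℂ] η) = ξ ⊗ₜ[ℂ] η ↔ V.op (η ⊗ₜ[ℂ] ξ) = η ⊗ₜ[ℂ] ξ := by
  rw [dual_op_tmul, ← TensorProduct.comm_tmul ℂ H H η ξ, EmbeddingLike.apply_eq_iff_eq]
  constructor
  · intro h
    conv_lhs => rw [← h]
    exact V.op_opStar_apply _
  · exact V.opStar_eq_self

theorem dual_L (V : MultiplicativeUnitary H) (ω) : V.dual.L ω = sliceRight ω V.opStar := by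
  rw [L, dual_op, sliceLeft_flipEnd]

theorem dual_rho (V : MultiplicativeUnitary H) (ω) : V.dual.rho ω = sliceLeft ω V.opStar := by
  rw [rho, dual_op, sliceRight_flipEnd]

theorem adjoint_dual_L_vecForm (V : MultiplicativeUnitary H) (ξ η : H) :
    LinearMap.adjoint (V.dual.L (vecForm ξ η)) = V.rho (vecForm η ξ) := by
  refine end_ext_inner fun ζ θ => ?_
  rw [LinearMap.adjoint_inner_right, dual_L, ← inner_conj_symm, inner_sliceRight, inner_opStar_right,
    inner_rho]
  exact inner_conj_symm (𝕜 := ℂ) (E := H ⊗[ℂ] H) _ _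

theorem dual_spaceS (V : MultiplicativeUnitary H) : V.dual.spaceS = V.spaceSHat := by
  refine le_antisymm ?_ ?_
  · rintro _ ⟨ω, rfl⟩
    rw [dual_L]
    exact sliceRight_mem V.one_mem_and_opStar_mem.2 ω
  · rintro _ ⟨ω, rfl⟩
    have h := V.dual.adjoint_mem_spaceS (V.dual.L_mem (dualStar ω))
    rw [dual_L, opStar, ← adjoint_sliceRight, LinearMap.adjoint_adjoint] at h
    exact h

theorem dual_comul (V : MultiplicativeUnitary H) (x : Module.End ℂ H) :
    V.dual.comul x = flipEnd (V.comulHat x) := by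
  rw [comul, comulHat, dual_op, dual_opStar, flipEnd_mul, flipEnd_mul, flipEnd_map]

theorem dual_lowerSpace (V : MultiplicativeUnitary H) (f : H) :
    V.dual.lowerSpace f = V.upperSpace f :=
  Submodule.ext fun η => V.dual_op_tmul_eq_iff η f

theorem mem_dual_fixedSpace (V : MultiplicativeUnitary H) (ξ : H) :
    ξ ∈ V.dual.fixedSpace ↔ V.IsCofixed ξ :=
  forall_congr' fun η => V.dual_op_tmul_eq_iff ξ η

theorem dual_isCofixed (V : MultiplicativeUnitary H) (ξ : H) :
    V.dual.IsCofixed ξ ↔ ξ ∈ V.fixedSpace :=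
  forall_congr' fun η => V.dual_op_tmul_eq_iff η ξ

theorem toSubmodule_S (V : MultiplicativeUnitary H) :
    Subalgebra.toSubmodule V.S.toSubalgebra = V.spaceS := rfl

theorem toSubmodule_SHat (V : MultiplicativeUnitary H) :
    Subalgebra.toSubmodule V.SHat.toSubalgebra = V.spaceSHat := rfl

end MultiplicativeUnitary

/-! ### The Haar projection, the trace, and cyclicity of the fixed vector. -/

namespace MultiplicativeUnitary

open MultUnitary

variable {H : Type*} [NormedAddCommGroup H] [InnerProductSpace ℂ H] [FiniteDimensional ℂ H]

theorem opStar_fixed (V : MultiplicativeUnitary H) {ξ : H} (hξ : ξ ∈ V.fixedSpace) (η : H) :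
    V.opStar (ξ ⊗ₜ[ℂ] η) = ξ ⊗ₜ[ℂ] η := V.opStar_eq_self (hξ η)

theorem opStar_cofixed (V : MultiplicativeUnitary H) {ξ : H} (hξ : V.IsCofixed ξ) (η : H) :
    V.opStar (η ⊗ₜ[ℂ] ξ) = η ⊗ₜ[ℂ] ξ := V.opStar_eq_self (hξ η)

/-- The scalar `ω 1` is the counit of `Ŝ` at `ρ(ω)`: the fixed vectors carry the trivial
representation of `Ŝ`. It comes from `L(ω_{ζ,ξ}) = ⟨ζ, ξ⟩ 1`. -/
theorem rho_apply_fixed (V : MultiplicativeUnitary H) {ξ : H} (hξ : ξ ∈ V.fixedSpace) (ω) :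
    V.rho ω ξ = ω 1 • ξ := by
  refine ext_inner_left ℂ fun ζ => ?_
  have h : V.L (vecForm ζ ξ) = (inner ℂ ζ ξ : ℂ) • 1 := by
    refine end_ext_inner fun α β => ?_
    rw [inner_L, hξ β]
    simp
  rw [← vecForm_apply ζ ξ, ← apply_L, h, map_smul, inner_smul_right, smul_eq_mul, mul_comm]

theorem L_apply_cofixed (V : MultiplicativeUnitary H) {ξ : H} (hξ : V.IsCofixed ξ) (ω) :
    V.L ω ξ = ω 1 • ξ := by
  refine ext_inner_left ℂ fun ζ => ?_
  have h : V.rho (vecForm ζ ξ) = (inner ℂ ζ ξ : ℂ) • 1 := by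
    refine end_ext_inner fun α β => ?_
    rw [inner_rho, hξ β]
    simp [mul_comm]
  rw [← vecForm_apply ζ ξ, apply_L, h, map_smul, inner_smul_right, smul_eq_mul, mul_comm]

theorem inner_rho_trace (V : MultiplicativeUnitary H) {ι : Type*} [Fintype ι]
    (b : OrthonormalBasis ι ℂ H) (ζ θ : H) :
    inner ℂ ζ (V.rho (LinearMap.trace ℂ H) θ) =
      ∑ i, inner ℂ (ζ ⊗ₜ[ℂ] b i) (V.op (θ ⊗ₜ[ℂ] b i)) := by
  rw [← vecForm_apply ζ θ, ← apply_L, LinearMap.trace_eq_sum_inner _ b]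
  simp only [inner_L]

/-- The projection onto the fixed vectors, as the normalized partial trace of `V`. -/
def haar (V : MultiplicativeUnitary H) : Module.End ℂ H :=
  (Module.finrank ℂ H : ℂ)⁻¹ • V.rho (LinearMap.trace ℂ H)

theorem finrank_smul_haar [Nontrivial H] (V : MultiplicativeUnitary H) :
    V.rho (LinearMap.trace ℂ H) = (Module.finrank ℂ H : ℂ) • V.haar := by
  have h : (Module.finrank ℂ H : ℂ) ≠ 0 := by exact_mod_cast Module.finrank_pos.ne'
  rw [haar, smul_inv_smul₀ h]

theorem haar_mem (V : MultiplicativeUnitary H) : V.haar ∈ V.spaceSHat :=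
  V.spaceSHat.smul_mem _ (V.rho_mem _)

/-- Paired with `ω`, the square becomes `(Tr ⊗ Tr)(V (x ⊗ 1) V*)` with `x = L(ω)`, which is `n Tr x`
because the trace is invariant under conjugation. -/
theorem rho_trace_mul_self (V : MultiplicativeUnitary H) :
    V.rho (LinearMap.trace ℂ H) * V.rho (LinearMap.trace ℂ H) =
      (Module.finrank ℂ H : ℂ) • V.rho (LinearMap.trace ℂ H) := by
  refine end_ext_dual fun ω => ?_
  rw [apply_rho_mul_rho, map_smul, ← apply_L]
  have h : dualTensor (LinearMap.trace ℂ H) (LinearMap.trace ℂ H) (V.comul (V.L ω)) =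
      LinearMap.trace ℂ H (sliceLeft (LinearMap.trace ℂ H) (V.comul (V.L ω))) := rfl
  rw [h, trace_sliceLeft, comul, mul_assoc, LinearMap.trace_mul_comm, mul_assoc, opStar_mul_op,
    mul_one, LinearMap.trace_tensorProduct', LinearMap.trace_one, smul_eq_mul, mul_comm]

theorem haar_mul_haar [Nontrivial H] (V : MultiplicativeUnitary H) :
    V.haar * V.haar = V.haar := by
  have h : (Module.finrank ℂ H : ℂ) ≠ 0 := by exact_mod_cast Module.finrank_pos.ne'
  have := V.rho_trace_mul_self
  rw [haar, smul_mul_smul_comm, this, smul_smul, mul_assoc, inv_mul_cancel₀ h, mul_one]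

theorem norm_haar_apply_le [Nontrivial H] (V : MultiplicativeUnitary H) (x : H) :
    ‖V.haar x‖ ≤ ‖x‖ := by
  have hn : (0 : ℝ) < Module.finrank ℂ H := by exact_mod_cast Module.finrank_pos
  have h : ∀ ζ, ‖(inner ℂ ζ (V.rho (LinearMap.trace ℂ H) x) : ℂ)‖ ≤
      Module.finrank ℂ H * (‖ζ‖ * ‖x‖) := by
    intro ζ
    rw [V.inner_rho_trace (stdOrthonormalBasis ℂ H)]
    refine (norm_sum_le _ _).trans ?_
    have : ∀ i ∈ Finset.univ, ‖(inner ℂ (ζ ⊗ₜ[ℂ] stdOrthonormalBasis ℂ H i)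
        (V.op (x ⊗ₜ[ℂ] stdOrthonormalBasis ℂ H i)) : ℂ)‖ ≤ ‖ζ‖ * ‖x‖ := by
      intro i _
      refine (norm_inner_le_norm (𝕜 := ℂ) (E := H ⊗[ℂ] H) _ _).trans ?_
      simp [norm_op]
    simpa using Finset.sum_le_card_nsmul _ _ _ this
  have h2 := h (V.haar x)
  rw [finrank_smul_haar, LinearMap.smul_apply, inner_smul_right, norm_mul,
    Complex.norm_natCast] at h2
  have h3 := le_of_mul_le_mul_left h2 hn
  rw [inner_self_eq_norm_sq_to_K] at h3
  have h4 : ‖V.haar x‖ ^ 2 ≤ ‖V.haar x‖ * ‖x‖ := by simpa using h3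
  rcases (norm_nonneg (V.haar x)).eq_or_lt with h0 | h0
  · rw [← h0]; exact norm_nonneg x
  · rw [sq] at h4
    exact le_of_mul_le_mul_left h4 h0

/-- The number `n ⟨x, haar x⟩` is a sum of `n` terms, each of real part at most `‖x‖²` since `V` is
unitary. If the sum is `n ‖x‖²`, each term is an equality case of Cauchy–Schwarz, so `V` fixes every
`x ⊗ bᵢ`. -/
theorem mem_fixedSpace_of_haar_apply [Nontrivial H] (V : MultiplicativeUnitary H) {x : H}
    (hx : V.haar x = x) : x ∈ V.fixedSpace := by
  set b := stdOrthonormalBasis ℂ H with hb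
  have h1 : (∑ i, inner ℂ (x ⊗ₜ[ℂ] b i) (V.op (x ⊗ₜ[ℂ] b i)) : ℂ) =
      ((∑ _i : Fin (Module.finrank ℂ H), ‖x‖ ^ 2 : ℝ) : ℂ) := by
    rw [← V.inner_rho_trace b, finrank_smul_haar, LinearMap.smul_apply, hx, inner_smul_right,
      inner_self_eq_norm_sq_to_K]
    simp
  have h2 : ∑ i, (inner ℂ (x ⊗ₜ[ℂ] b i) (V.op (x ⊗ₜ[ℂ] b i)) : ℂ).re =
      ∑ _i : Fin (Module.finrank ℂ H), ‖x‖ ^ 2 := by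
    rw [← Complex.re_sum, h1, Complex.ofReal_re]
  have hle : ∀ i ∈ Finset.univ, (inner ℂ (x ⊗ₜ[ℂ] b i) (V.op (x ⊗ₜ[ℂ] b i)) : ℂ).re ≤ ‖x‖ ^ 2 := by
    intro i _
    refine (Complex.re_le_norm _).trans
      ((norm_inner_le_norm (𝕜 := ℂ) (E := H ⊗[ℂ] H) _ _).trans ?_)
    simp [norm_op, sq]
  have h3 := (Finset.sum_eq_sum_iff_of_le hle).1 h2
  have h4 : ∀ i, V.op (x ⊗ₜ[ℂ] b i) = x ⊗ₜ[ℂ] b i := fun i =>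
    V.op_eq_self_of_inner (by rw [h3 i (Finset.mem_univ i)]; simp)
  intro η
  have h5 : V.op ∘ₗ TensorProduct.mk ℂ H H x = TensorProduct.mk ℂ H H x :=
    b.toBasis.ext fun i => by simpa using h4 i
  exact LinearMap.congr_fun h5 η

theorem haar_apply_mem_fixedSpace [Nontrivial H] (V : MultiplicativeUnitary H) (x : H) :
    V.haar x ∈ V.fixedSpace :=
  V.mem_fixedSpace_of_haar_apply (LinearMap.congr_fun V.haar_mul_haar x)

theorem adjoint_haar [Nontrivial H] (V : MultiplicativeUnitary H) :
    LinearMap.adjoint V.haar = V.haar :=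
  adjoint_eq_of_idempotent_contraction V.haar_mul_haar V.norm_haar_apply_le

theorem haar_apply_fixed [Nontrivial H] (V : MultiplicativeUnitary H) {x : H}
    (hx : x ∈ V.fixedSpace) : V.haar x = x := by
  have h : (Module.finrank ℂ H : ℂ) ≠ 0 := by exact_mod_cast Module.finrank_pos.ne'
  rw [haar, LinearMap.smul_apply, V.rho_apply_fixed hx, LinearMap.trace_one, smul_smul,
    inv_mul_cancel₀ h, one_smul]

theorem rho_mul_haar [Nontrivial H] (V : MultiplicativeUnitary H) (ω) :
    V.rho ω * V.haar = ω 1 • V.haar :=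
  LinearMap.ext fun x => V.rho_apply_fixed (V.haar_apply_mem_fixedSpace x) ω

/-- Right invariance of the trace. -/
theorem dualTensor_trace_comul [Nontrivial H] (V : MultiplicativeUnitary H) {x : Module.End ℂ H}
    (hx : x ∈ V.spaceS) (ω : Module.Dual ℂ (Module.End ℂ H)) :
    dualTensor ω (LinearMap.trace ℂ H) (V.comul x) = ω 1 * LinearMap.trace ℂ H x := by
  obtain ⟨ω', rfl⟩ := hx
  rw [← apply_rho_mul_rho, finrank_smul_haar, mul_smul_comm, rho_mul_haar, smul_comm,
    ← finrank_smul_haar, map_smul, ← apply_L, smul_eq_mul]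

theorem sliceLeft_fixed_comul (V : MultiplicativeUnitary H) {e : H} (he : e ∈ V.fixedSpace)
    (x : Module.End ℂ H) :
    sliceLeft (vecForm e e) (V.comul x) = (inner ℂ e (x e) : ℂ) • 1 := by
  refine end_ext_inner fun ζ θ => ?_
  rw [inner_sliceLeft, comul, Module.End.mul_apply, Module.End.mul_apply, V.opStar_fixed he,
    ← inner_opStar_left, V.opStar_fixed he]
  simp

/-- Compute `(ω_{e,e} ⊗ Tr)(δ(x))` in two ways: invariance gives `Tr x`, while slicing by the fixed
vector leaves `⟨e, x e⟩ Tr 1`. -/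
theorem trace_eq_inner_fixed [Nontrivial H] (V : MultiplicativeUnitary H) {e : H}
    (he : e ∈ V.fixedSpace) (he_norm : ‖e‖ = 1) {x : Module.End ℂ H} (hx : x ∈ V.spaceS) :
    LinearMap.trace ℂ H x = Module.finrank ℂ H * inner ℂ e (x e) := by
  have h := V.dualTensor_trace_comul hx (vecForm e e)
  have h1 : vecForm e e 1 = 1 := by
    rw [vecForm_apply, Module.End.one_apply, inner_self_eq_norm_sq_to_K, he_norm]; simp
  rw [h1, one_mul, dualTensor, LinearMap.comp_apply, V.sliceLeft_fixed_comul he, map_smul,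
    LinearMap.trace_one, smul_eq_mul, mul_comm] at h
  exact h.symm

theorem eq_zero_of_apply_fixed [Nontrivial H] (V : MultiplicativeUnitary H) {e : H}
    (he : e ∈ V.fixedSpace) (he_norm : ‖e‖ = 1) {x : Module.End ℂ H} (hx : x ∈ V.spaceS)
    (h : x e = 0) : x = 0 := by
  refine eq_zero_of_trace_adjoint_mul ?_
  rw [V.trace_eq_inner_fixed he he_norm (V.spaceS_mul _ (V.adjoint_mem_spaceS hx) _ hx),
    Module.End.mul_apply, h, map_zero, inner_zero_right, mul_zero]

theorem eq_inner_smul_of_multiplicity (V : MultiplicativeUnitary H) (hV : V.multiplicity = 1)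
    {e : H} (he : e ∈ V.fixedSpace) (he_norm : ‖e‖ = 1) {ξ : H} (hξ : ξ ∈ V.fixedSpace) :
    ξ = (inner ℂ e ξ : ℂ) • e := by
  have he0 : (⟨e, he⟩ : V.fixedSpace) ≠ 0 := by
    intro h
    have : e = 0 := congrArg Subtype.val h
    rw [this, norm_zero] at he_norm
    exact zero_ne_one he_norm
  obtain ⟨r, hr⟩ := (finrank_eq_one_iff_of_nonzero' _ he0).1 hV ⟨ξ, hξ⟩
  have hr' : r • e = ξ := congrArg Subtype.val hr
  rw [← hr', inner_smul_right, inner_self_eq_norm_sq_to_K, he_norm]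
  simp

/-- In multiplicity one, the fixed vector is cyclic for `S`. -/
theorem eq_zero_of_inner_fixed [Nontrivial H] (V : MultiplicativeUnitary H)
    (hV : V.multiplicity = 1) {e : H} (he : e ∈ V.fixedSpace) (he_norm : ‖e‖ = 1) {ξ : H}
    (hξ : ∀ x ∈ V.spaceS, inner ℂ ξ (x e) = 0) : ξ = 0 := by
  have hq : ∀ θ, V.haar θ = (inner ℂ e θ : ℂ) • e := by
    intro θ
    conv_lhs => rw [V.eq_inner_smul_of_multiplicity hV he he_norm (V.haar_apply_mem_fixedSpace θ)]
    rw [← LinearMap.adjoint_inner_left, V.adjoint_haar, V.haar_apply_fixed he]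
  -- Invariance of the trace for the dual, applied to `haar`, which is now the rank-one projection
  -- onto `e`. The right-hand side is `‖ξ‖²`; the left-hand side is a sum of terms `⟨ξ ⊗ b, V̂ (e ⊗
  -- η)⟩`, where `V̂ = Σ V* Σ`, and these vanish because `ξ` is orthogonal to `S e`.
  have h := V.dual.dualTensor_trace_comul (x := V.haar)
    (by rw [dual_spaceS]; exact V.haar_mem) (vecForm ξ ξ)
  have htr : LinearMap.trace ℂ H V.haar = 1 := by
    rw [LinearMap.trace_eq_sum_inner _ (stdOrthonormalBasis ℂ H)]
    have := (stdOrthonormalBasis ℂ H).sum_inner_mul_inner e e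
    simp only [hq, inner_smul_right]
    rw [this, inner_self_eq_norm_sq_to_K, he_norm]
    simp
  have hS : ∀ b η : H, inner ℂ (ξ ⊗ₜ[ℂ] b) (V.dual.op (e ⊗ₜ[ℂ] η)) = (0 : ℂ) := by
    intro b η
    rw [dual_op_tmul, ← TensorProduct.comm_tmul ℂ H H b ξ, TensorProduct.inner_comm_comm,
      ← inner_sliceLeft]
    exact hξ _ (sliceLeft_mem V.one_mem_and_opStar_mem.2 _)
  have hz : ∀ X : H ⊗[ℂ] H, ∃ η, TensorProduct.map V.haar (1 : Module.End ℂ H) X = e ⊗ₜ[ℂ] η := by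
    intro X
    induction X using TensorProduct.induction_on with
    | zero => exact ⟨0, by simp⟩
    | tmul x y =>
      exact ⟨(inner ℂ e x : ℂ) • y, by
        rw [TensorProduct.map_tmul, hq, TensorProduct.smul_tmul, Module.End.one_apply]⟩
    | add x y hx hy =>
      obtain ⟨a, ha⟩ := hx
      obtain ⟨b, hb⟩ := hy
      exact ⟨a + b, by rw [map_add, ha, hb, TensorProduct.tmul_add]⟩
  have h0 : dualTensor (vecForm ξ ξ) (LinearMap.trace ℂ H) (V.dual.comul V.haar) = 0 := by
    rw [dualTensor, LinearMap.comp_apply, LinearMap.trace_eq_sum_inner _ (stdOrthonormalBasis ℂ H)]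
    refine Finset.sum_eq_zero fun i _ => ?_
    rw [inner_sliceLeft, comul, Module.End.mul_apply, Module.End.mul_apply]
    obtain ⟨η, hη⟩ := hz (V.dual.opStar (ξ ⊗ₜ[ℂ] stdOrthonormalBasis ℂ H i))
    rw [hη, hS]
  rw [h0, htr, mul_one, vecForm_apply, Module.End.one_apply] at h
  exact inner_self_eq_zero.1 h.symm

end MultiplicativeUnitary

/-! ### The identification of `S` with `H`, the conjugations `J` and `Ĵ`, and the unitary `U`. -/

namespace MultiplicativeUnitary

open MultUnitary

variable {H : Type*} [NormedAddCommGroup H] [InnerProductSpace ℂ H] [FiniteDimensional ℂ H]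

/-- The scalar `n ^ (-1/2)`, where `n = dim H`. -/
def normScalar (H : Type*) [NormedAddCommGroup H] [InnerProductSpace ℂ H] : ℝ :=
  (Real.sqrt (Module.finrank ℂ H))⁻¹

theorem normScalar_pos (H : Type*) [NormedAddCommGroup H] [InnerProductSpace ℂ H]
    [FiniteDimensional ℂ H] [Nontrivial H] : 0 < normScalar H := by
  have : (0 : ℝ) < Module.finrank ℂ H := by exact_mod_cast Module.finrank_pos
  exact inv_pos.2 (Real.sqrt_pos.2 this)

/-- `V` has multiplicity one, `e` is a fixed unit vector, and `e'` the cofixed unit vector with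
`⟨e, e'⟩ = n ^ (-1/2)`. -/
structure StandardPair (V : MultiplicativeUnitary H) (e e' : H) : Prop where
  multiplicity : V.multiplicity = 1
  fixed : e ∈ V.fixedSpace
  norm_fixed : ‖e‖ = 1
  cofixed : V.IsCofixed e'
  norm_cofixed : ‖e'‖ = 1
  inner_eq : inner ℂ e e' = (normScalar H : ℂ)

/-- The linear map sending `ξ` to the element `x` of `S` with `x e = ξ`. -/
def ofVec (V : MultiplicativeUnitary H) (e' : H) : H →ₗ[ℂ] Module.End ℂ H where
  toFun ξ := (normScalar H : ℂ)⁻¹ • V.L (vecForm e' ξ)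
  map_add' ξ η := by
    refine end_ext_inner fun ζ θ => ?_
    simp only [LinearMap.smul_apply, LinearMap.add_apply, inner_smul_right, inner_add_right,
      inner_L, TensorProduct.add_tmul, map_add, mul_add]
  map_smul' r ξ := by
    refine end_ext_inner fun ζ θ => ?_
    simp only [LinearMap.smul_apply, inner_smul_right, inner_L, ← TensorProduct.smul_tmul',
      map_smul, RingHom.id_apply]
    rw [← mul_assoc, mul_comm r, mul_assoc]
    exact congrArg _ (inner_smul_right (𝕜 := ℂ) (E := H ⊗[ℂ] H) _ _ r)

/-- The antiunitary involution `x e ↦ x* e` (`x ∈ S`). -/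
def modConj (V : MultiplicativeUnitary H) (e e' : H) : H →ₗ⋆[ℂ] H where
  toFun ξ := LinearMap.adjoint (V.ofVec e' ξ) e
  map_add' ξ η := by rw [map_add, map_add, LinearMap.add_apply]
  map_smul' r ξ := by rw [map_smul, map_smulₛₗ, LinearMap.smul_apply]

/-- The bridge from the coproduct to vectors: it holds because `V*` fixes `e ⊗ θ`. -/
theorem comul_fixed (V : MultiplicativeUnitary H) {e : H} (he : e ∈ V.fixedSpace)
    (x : Module.End ℂ H) (θ : H) : V.comul x (e ⊗ₜ[ℂ] θ) = V.op (x e ⊗ₜ[ℂ] θ) := by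
  rw [comul, Module.End.mul_apply, Module.End.mul_apply, V.opStar_fixed he,
    TensorProduct.map_tmul, Module.End.one_apply]

theorem ofVec_mem (V : MultiplicativeUnitary H) (e' ξ : H) : V.ofVec e' ξ ∈ V.spaceS :=
  V.spaceS.smul_mem _ (V.L_mem _)

theorem rho_vecForm_cofixed (V : MultiplicativeUnitary H) {e' : H} (he' : V.IsCofixed e')
    (ξ : H) : V.rho (vecForm e' ξ) = (inner ℂ e' ξ : ℂ) • 1 := by
  refine end_ext_inner fun α β => ?_
  rw [inner_rho, ← inner_opStar_left, V.opStar_cofixed he']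
  simp [mul_comm]

namespace StandardPair

variable {V : MultiplicativeUnitary H} {e e' : H}

theorem nontrivial (h : StandardPair V e e') : Nontrivial H :=
  ⟨e, 0, fun h0 => by simpa [h0] using h.norm_fixed⟩

theorem normScalar_pos (h : StandardPair V e e') : 0 < normScalar H :=
  have := h.nontrivial
  MultiplicativeUnitary.normScalar_pos H

theorem normScalar_ne_zero (h : StandardPair V e e') : (normScalar H : ℂ) ≠ 0 := by
  exact_mod_cast h.normScalar_pos.ne'

theorem inner_eq' (h : StandardPair V e e') : inner ℂ e' e = (normScalar H : ℂ) := by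
  rw [← inner_conj_symm, h.inner_eq, Complex.conj_ofReal]

theorem eq_zero_of_inner (h : StandardPair V e e') {ξ : H}
    (hξ : ∀ x ∈ V.spaceS, inner ℂ ξ (x e) = 0) : ξ = 0 :=
  have := h.nontrivial
  V.eq_zero_of_inner_fixed h.multiplicity h.fixed h.norm_fixed hξ

theorem ext (h : StandardPair V e e') {x y : Module.End ℂ H} (hx : x ∈ V.spaceS)
    (hy : y ∈ V.spaceS) (hxy : x e = y e) : x = y := by
  have := h.nontrivial
  refine sub_eq_zero.1 (V.eq_zero_of_apply_fixed h.fixed h.norm_fixed (V.spaceS.sub_mem hx hy) ?_)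
  rw [LinearMap.sub_apply, hxy, sub_self]

theorem exists_apply_eq (h : StandardPair V e e') (ξ : H) : ∃ x ∈ V.spaceS, x e = ξ := by
  have h1 : V.spaceS.map (LinearMap.applyₗ e : Module.End ℂ H →ₗ[ℂ] H) = ⊤ := by
    rw [← Submodule.orthogonal_eq_bot_iff, Submodule.eq_bot_iff]
    intro ξ hξ
    refine h.eq_zero_of_inner fun x hx => ?_
    exact (Submodule.mem_orthogonal' _ _).1 hξ _ ⟨x, hx, rfl⟩
  have h2 : ξ ∈ V.spaceS.map (LinearMap.applyₗ e : Module.End ℂ H →ₗ[ℂ] H) := by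
    rw [h1]; trivial
  exact h2

/-- `L(ω_{ê,xe})` is the slice of `δ(x)` by `ω_{ê,e}`. Since `ρ(ω_{ê,e})` is the scalar `⟨ê, e⟩`,
this slice is `⟨ê, e⟩ x`, which explains the factor in `ofVec`. -/
theorem ofVec_apply_of_mem (h : StandardPair V e e') {x : Module.End ℂ H} (hx : x ∈ V.spaceS) :
    V.ofVec e' (x e) = x := by
  refine end_ext_inner fun ζ θ => ?_
  obtain ⟨ω, rfl⟩ := hx
  change inner ℂ ζ (((normScalar H : ℂ)⁻¹ • V.L (vecForm e' (V.L ω e))) θ) = _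
  have h1 : dualTensor (vecForm e' e) (vecForm ζ θ) (V.comul (V.L ω)) =
      inner ℂ ζ (sliceLeft (vecForm e' e) (V.comul (V.L ω)) θ) := rfl
  rw [LinearMap.smul_apply, inner_smul_right, inner_L, ← V.comul_fixed h.fixed,
    ← inner_sliceLeft, ← h1, ← apply_rho_mul_rho, V.rho_vecForm_cofixed h.cofixed, h.inner_eq',
    smul_mul_assoc, one_mul, map_smul, ← apply_L, smul_eq_mul, inv_mul_cancel_left₀
    h.normScalar_ne_zero, vecForm_apply]

theorem ofVec_apply (h : StandardPair V e e') (ξ : H) : V.ofVec e' ξ e = ξ := by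
  obtain ⟨x, hx, rfl⟩ := h.exists_apply_eq ξ
  rw [h.ofVec_apply_of_mem hx]

/-- The dual of a standard pair is standard. -/
theorem dual (h : StandardPair V e e') : StandardPair V.dual e' e where
  multiplicity := by
    have he' : e' ∈ V.dual.fixedSpace := (V.mem_dual_fixedSpace e').2 h.cofixed
    have he0 : (⟨e', he'⟩ : V.dual.fixedSpace) ≠ 0 := by
      intro h0
      have h1 : e' = 0 := congrArg Subtype.val h0
      have := h.norm_cofixed
      rw [h1, norm_zero] at this
      exact zero_ne_one this
    refine (finrank_eq_one_iff_of_nonzero' _ he0).2 ?_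
    rintro ⟨ξ, hξ⟩
    have hc := h.normScalar_ne_zero
    -- The scalar that makes `η - ξ` orthogonal to `e`. As `S` acts by scalars on cofixed vectors,
    -- `η - ξ` is then orthogonal to all of `S e`, hence zero.
    refine ⟨(normScalar H : ℂ)⁻¹ * inner ℂ e ξ, Subtype.ext ?_⟩
    set η := ((normScalar H : ℂ)⁻¹ * inner ℂ e ξ) • e' with hη
    have hη_mem : η - ξ ∈ V.dual.fixedSpace :=
      V.dual.fixedSpace.sub_mem (V.dual.fixedSpace.smul_mem _ he') hξ
    have horth : inner ℂ e (η - ξ) = (0 : ℂ) := by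
      rw [inner_sub_right, hη, inner_smul_right, h.inner_eq, mul_comm,
        mul_inv_cancel_left₀ hc, sub_self]
    refine sub_eq_zero.1 (h.eq_zero_of_inner fun x hx => ?_)
    obtain ⟨ω, hω⟩ := V.adjoint_mem_spaceS hx
    change inner ℂ (η - ξ) (x e) = 0
    rw [← LinearMap.adjoint_inner_left, ← hω,
      V.L_apply_cofixed ((V.mem_dual_fixedSpace _).1 hη_mem), inner_smul_left, ← inner_conj_symm,
      horth, map_zero, mul_zero]
  fixed := (V.mem_dual_fixedSpace e').2 h.cofixed
  norm_fixed := h.norm_cofixed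
  cofixed := (V.dual_isCofixed e).2 h.fixed
  norm_cofixed := h.norm_fixed
  inner_eq := h.inner_eq'

theorem tracial (h : StandardPair V e e') {x y : Module.End ℂ H} (hx : x ∈ V.spaceS)
    (hy : y ∈ V.spaceS) : (inner ℂ e (x (y e)) : ℂ) = inner ℂ e (y (x e)) := by
  have := h.nontrivial
  have hn : (Module.finrank ℂ H : ℂ) ≠ 0 := by exact_mod_cast Module.finrank_pos.ne'
  have h1 := V.trace_eq_inner_fixed h.fixed h.norm_fixed (V.spaceS_mul x hx y hy)
  have h2 := V.trace_eq_inner_fixed h.fixed h.norm_fixed (V.spaceS_mul y hy x hx)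
  rw [LinearMap.trace_mul_comm] at h1
  exact mul_left_cancel₀ hn (h1.symm.trans h2)

theorem modConj_apply_of_mem (h : StandardPair V e e') {x : Module.End ℂ H} (hx : x ∈ V.spaceS) :
    V.modConj e e' (x e) = LinearMap.adjoint x e := by
  change LinearMap.adjoint (V.ofVec e' (x e)) e = _
  rw [h.ofVec_apply_of_mem hx]

theorem modConj_modConj (h : StandardPair V e e') (ξ : H) :
    V.modConj e e' (V.modConj e e' ξ) = ξ := by
  obtain ⟨x, hx, rfl⟩ := h.exists_apply_eq ξ
  rw [h.modConj_apply_of_mem hx, h.modConj_apply_of_mem (V.adjoint_mem_spaceS hx),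
    LinearMap.adjoint_adjoint]

theorem inner_modConj_modConj (h : StandardPair V e e') (ξ η : H) :
    (inner ℂ (V.modConj e e' ξ) (V.modConj e e' η) : ℂ) = inner ℂ η ξ := by
  obtain ⟨x, hx, rfl⟩ := h.exists_apply_eq ξ
  obtain ⟨y, hy, rfl⟩ := h.exists_apply_eq η
  rw [h.modConj_apply_of_mem hx, h.modConj_apply_of_mem hy, LinearMap.adjoint_inner_left,
    h.tracial hx (V.adjoint_mem_spaceS hy), LinearMap.adjoint_inner_right]

theorem inner_modConj_left (h : StandardPair V e e') (ξ η : H) :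
    (inner ℂ (V.modConj e e' ξ) η : ℂ) = inner ℂ (V.modConj e e' η) ξ := by
  rw [← h.inner_modConj_modConj, h.modConj_modConj]

theorem inner_modConj_right (h : StandardPair V e e') (ξ η : H) :
    (inner ℂ ξ (V.modConj e e' η) : ℂ) = inner ℂ η (V.modConj e e' ξ) := by
  rw [← h.inner_modConj_modConj, h.modConj_modConj]

theorem norm_modConj (h : StandardPair V e e') (ξ : H) : ‖V.modConj e e' ξ‖ = ‖ξ‖ := by
  have h1 : ‖V.modConj e e' ξ‖ ^ 2 = ‖ξ‖ ^ 2 := by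
    have := h.inner_modConj_modConj ξ ξ
    rw [inner_self_eq_norm_sq_to_K, inner_self_eq_norm_sq_to_K] at this
    exact Complex.ofReal_injective (by push_cast; exact this)
  exact (sq_eq_sq₀ (norm_nonneg _) (norm_nonneg _)).1 h1

theorem modConj_fixed (h : StandardPair V e e') : V.modConj e e' e = e := by
  have := h.modConj_apply_of_mem V.one_mem_spaceS
  have h2 : LinearMap.adjoint (1 : Module.End ℂ H) = 1 := LinearMap.adjoint_id
  rwa [h2, Module.End.one_apply] at this

/-- `S` acts on `ê` by the counit, and `h4` says that the counit respects the involution; the two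
vectors therefore have the same inner products with `S e`. -/
theorem modConj_cofixed (h : StandardPair V e e') : V.modConj e e' e' = e' := by
  refine sub_eq_zero.1 (h.eq_zero_of_inner fun x hx => ?_)
  obtain ⟨ω, hω⟩ := V.adjoint_mem_spaceS hx
  obtain ⟨ω', rfl⟩ := hx
  have h2 : LinearMap.adjoint (V.L ω') e' = ω 1 • e' := by
    rw [← hω, V.L_apply_cofixed h.cofixed]
  have h3 : (inner ℂ e' (V.L ω' e') : ℂ) = inner ℂ (ω 1 • e') e' := by
    rw [← h2, LinearMap.adjoint_inner_left]
  rw [V.L_apply_cofixed h.cofixed, inner_smul_right, inner_smul_left, inner_self_eq_norm_sq_to_K,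
    h.norm_cofixed] at h3
  have h4 : ω' 1 = (starRingEnd ℂ) (ω 1) := by simpa using h3
  rw [inner_sub_left, h.inner_modConj_left, h.modConj_apply_of_mem (V.L_mem ω'),
    LinearMap.adjoint_inner_left, V.L_apply_cofixed h.cofixed, inner_smul_right, h.inner_eq,
    ← LinearMap.adjoint_inner_left, h2, inner_smul_left, h.inner_eq', h4, sub_self]

/-- The vector `V*(ê ⊗ e)` is the kernel of `J`; dually, `V(ê ⊗ e)` is that of `Ĵ`. This links the
conjugations to slices of `V` and `V*`. -/
theorem inner_opStar_cofixed_fixed (h : StandardPair V e e') (ξ ζ : H) :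
    inner ℂ (ξ ⊗ₜ[ℂ] ζ) (V.opStar (e' ⊗ₜ[ℂ] e)) =
      (normScalar H : ℂ) * inner ℂ ζ (V.modConj e e' ξ) := by
  have h1 : V.L (vecForm e' ξ) = (normScalar H : ℂ) • V.ofVec e' ξ := by
    change _ = (normScalar H : ℂ) • (normScalar H : ℂ)⁻¹ • V.L (vecForm e' ξ)
    rw [smul_inv_smul₀ h.normScalar_ne_zero]
  rw [inner_opStar_right, ← inner_conj_symm (𝕜 := ℂ) (E := H ⊗[ℂ] H)]
  change (starRingEnd ℂ) (inner ℂ (e' ⊗ₜ[ℂ] e) (V.op (ξ ⊗ₜ[ℂ] ζ))) = _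
  rw [← inner_L, h1, LinearMap.smul_apply, inner_smul_right, map_mul, Complex.conj_ofReal,
    inner_conj_symm]
  change _ = _ * inner ℂ ζ (LinearMap.adjoint (V.ofVec e' ξ) e)
  rw [LinearMap.adjoint_inner_right]

theorem inner_op_cofixed_fixed (h : StandardPair V e e') (ζ ξ : H) :
    inner ℂ (ζ ⊗ₜ[ℂ] ξ) (V.op (e' ⊗ₜ[ℂ] e)) =
      (normScalar H : ℂ) * inner ℂ ζ (V.dual.modConj e' e ξ) := by
  rw [← h.dual.inner_opStar_cofixed_fixed, dual_opStar_tmul, ← TensorProduct.comm_tmul ℂ H H ζ ξ,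
    TensorProduct.inner_comm_comm]

theorem L_vecForm_cofixed_apply (h : StandardPair V e e') (ζ : H) :
    V.L (vecForm ζ e') e = (normScalar H : ℂ) • V.dual.modConj e' e ζ := by
  refine ext_inner_left ℂ fun ξ => ?_
  rw [inner_L, h.inner_op_cofixed_fixed, inner_smul_right, h.dual.inner_modConj_right]

/-- The Riesz theorem, transported from `H` to `S` by `ofVec`. -/
theorem exists_vecForm (h : StandardPair V e e') (ω : Module.Dual ℂ (Module.End ℂ H)) :
    ∃ ξ, ∀ x ∈ V.spaceS, ω x = vecForm ξ e x := by
  let ℓ : H →ₗ[ℂ] ℂ := ω ∘ₗ V.ofVec e'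
  refine ⟨(InnerProductSpace.toDual ℂ H).symm (LinearMap.toContinuousLinearMap ℓ), fun x hx => ?_⟩
  rw [vecForm_apply, InnerProductSpace.toDual_symm_apply]
  change _ = ω (V.ofVec e' (x e))
  rw [h.ofVec_apply_of_mem hx]

theorem exists_vecForm_hat (h : StandardPair V e e') (ω : Module.Dual ℂ (Module.End ℂ H)) :
    ∃ ξ, ∀ y ∈ V.spaceSHat, ω y = vecForm ξ e' y := by
  obtain ⟨ξ, hξ⟩ := h.dual.exists_vecForm ω
  rw [dual_spaceS] at hξ
  exact ⟨ξ, hξ⟩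

/-- Write `ξ = z ê` and `η = v ê` with `z, v ∈ Ŝ`. The vector state of `ê` is tracial on `Ŝ`, so `⟨z
ê, y v ê⟩ = ⟨z v* ê, y ê⟩`: on `Ŝ` the form `ω_{ξ,η}` equals `ω_{z Ĵη, ê}`, and
`L_vecForm_cofixed_apply` applies. -/
theorem L_vecForm_apply (h : StandardPair V e e') (ξ η : H) :
    V.L (vecForm ξ η) e = (normScalar H : ℂ) •
      V.dual.modConj e' e (V.dual.ofVec e ξ (V.dual.modConj e' e η)) := by
  rw [← h.L_vecForm_cofixed_apply]
  refine LinearMap.congr_fun (sliceLeft_congr V.op_mem fun y hy => ?_) e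
  rw [← dual_spaceS] at hy
  obtain ⟨v, hv, rfl⟩ := h.dual.exists_apply_eq η
  obtain ⟨z, hz, rfl⟩ := h.dual.exists_apply_eq ξ
  have hz' := V.dual.adjoint_mem_spaceS hz
  rw [h.dual.ofVec_apply_of_mem hz, h.dual.modConj_apply_of_mem hv, vecForm_apply, vecForm_apply,
    ← LinearMap.adjoint_inner_right, ← LinearMap.adjoint_inner_right z,
    LinearMap.adjoint_inner_left]
  exact h.dual.tracial (V.dual.spaceS_mul _ hz' _ hy) hv

theorem inner_tensorSpan_apply (h : StandardPair V e e') {T : Module.End ℂ (H ⊗[ℂ] H)}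
    (hT : T ∈ tensorSpan V.spaceS V.spaceS) (ξ η : H) :
    inner ℂ (T (e ⊗ₜ[ℂ] e)) (V.modConj e e' ξ ⊗ₜ[ℂ] V.modConj e e' η) =
      inner ℂ (ξ ⊗ₜ[ℂ] η) (LinearMap.adjoint T (e ⊗ₜ[ℂ] e)) := by
  refine Submodule.span_induction (p := fun T _ =>
    inner ℂ (T (e ⊗ₜ[ℂ] e)) (V.modConj e e' ξ ⊗ₜ[ℂ] V.modConj e e' η) =
      inner ℂ (ξ ⊗ₜ[ℂ] η) (LinearMap.adjoint T (e ⊗ₜ[ℂ] e))) ?_ ?_ ?_ ?_ hT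
  · rintro _ ⟨a, ha, b, hb, rfl⟩
    rw [TensorProduct.adjoint_map, TensorProduct.map_tmul, TensorProduct.map_tmul,
      TensorProduct.inner_tmul, TensorProduct.inner_tmul, h.inner_modConj_right (a e),
      h.inner_modConj_right (b e), h.modConj_apply_of_mem ha, h.modConj_apply_of_mem hb]
  · simp
  · intro x y _ _ hx hy
    rw [LinearMap.add_apply, map_add, LinearMap.add_apply]
    erw [inner_add_left, inner_add_right]
    exact congrArg₂ (· + ·) hx hy
  · intro r x _ hx
    rw [LinearMap.smul_apply, map_smulₛₗ, LinearMap.smul_apply]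
    erw [inner_smul_left, inner_smul_right]
    exact congrArg _ hx

/-- If `y_ξ ∈ Ŝ` denotes the element with `y_ξ ê = ξ`, this is `J y_ξ J = y_{Jξ}`, so `J` normalizes
`Ŝ`. Up to a real factor, `⟨z e, y_ξ θ⟩` is `⟨δ(z)(e ⊗ e), θ ⊗ ξ⟩`, and `δ` preserves the
involution, which `J ⊗ J` implements on `S ⊗ S`. -/
theorem modConj_ofVec_dual (h : StandardPair V e e') (ξ θ : H) :
    V.modConj e e' (V.dual.ofVec e ξ θ) =
      V.dual.ofVec e (V.modConj e e' ξ) (V.modConj e e' θ) := by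
  have key : ∀ z ∈ V.spaceS, ∀ ξ θ : H, (inner ℂ (z e) (V.dual.ofVec e ξ θ) : ℂ) =
      (normScalar H : ℂ)⁻¹ * inner ℂ (V.comul z (e ⊗ₜ[ℂ] e)) (θ ⊗ₜ[ℂ] ξ) := by
    intro z _ ξ θ
    change inner ℂ (z e) (((normScalar H : ℂ)⁻¹ • V.dual.L (vecForm e ξ)) θ) = _
    rw [LinearMap.smul_apply, inner_smul_right, inner_L, ← inner_opStar_left, dual_opStar_tmul,
      ← TensorProduct.comm_tmul ℂ H H θ ξ, TensorProduct.inner_comm_comm, V.comul_fixed h.fixed]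
  refine ext_inner_left ℂ fun ζ => ?_
  obtain ⟨z, hz, rfl⟩ := h.exists_apply_eq ζ
  rw [key z hz, h.inner_tensorSpan_apply (V.comul_mem hz), ← comul_adjoint,
    h.inner_modConj_right, h.modConj_apply_of_mem hz, ← inner_conj_symm,
    key _ (V.adjoint_mem_spaceS hz), map_mul, map_inv₀, Complex.conj_ofReal]
  congr 1
  exact inner_conj_symm (𝕜 := ℂ) (E := H ⊗[ℂ] H) _ _

theorem modConj_dual_ofVec (h : StandardPair V e e') (ξ θ : H) :
    V.dual.modConj e' e (V.ofVec e' ξ θ) =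
      V.ofVec e' (V.dual.modConj e' e ξ) (V.dual.modConj e' e θ) := by
  have := h.dual.modConj_ofVec_dual ξ θ
  rwa [dual_dual] at this

/-- `Ĵ x_ξ Ĵ = x_{Ĵξ}`, where `x_ξ e = ξ`; take adjoints and evaluate at `e`, which `Ĵ` fixes. -/
theorem modConj_comm (h : StandardPair V e e') (ξ : H) :
    V.modConj e e' (V.dual.modConj e' e ξ) = V.dual.modConj e' e (V.modConj e e' ξ) := by
  refine ext_inner_left ℂ fun ζ => ?_
  change inner ℂ ζ (LinearMap.adjoint (V.ofVec e' (V.dual.modConj e' e ξ)) e) =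
    inner ℂ ζ (V.dual.modConj e' e (LinearMap.adjoint (V.ofVec e' ξ) e))
  rw [LinearMap.adjoint_inner_right, h.dual.inner_modConj_right, LinearMap.adjoint_inner_left,
    ← h.dual.modConj_modConj ζ, ← h.modConj_dual_ofVec, h.dual.inner_modConj_left,
    h.dual.modConj_cofixed, h.dual.modConj_modConj]

/-- The operator `U = J Ĵ` implementing the antipode. -/
def antipodeEquiv (h : StandardPair V e e') : H ≃ₗ[ℂ] H where
  toFun ξ := V.modConj e e' (V.dual.modConj e' e ξ)
  invFun ξ := V.modConj e e' (V.dual.modConj e' e ξ)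
  map_add' ξ η := by rw [map_add, map_add]
  map_smul' r ξ := by rw [map_smulₛₗ, map_smulₛₗ, Complex.conj_conj, RingHom.id_apply]
  left_inv ξ := by beta_reduce; rw [h.modConj_comm, h.modConj_modConj, h.dual.modConj_modConj]
  right_inv ξ := by beta_reduce; rw [h.modConj_comm, h.modConj_modConj, h.dual.modConj_modConj]

/-- The unitary `U = J Ĵ` implementing the antipode. -/
def antipodeUnitary (h : StandardPair V e e') : H ≃ₗᵢ[ℂ] H where
  toLinearEquiv := h.antipodeEquiv
  norm_map' ξ := by
    change ‖V.modConj e e' (V.dual.modConj e' e ξ)‖ = ‖ξ‖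
    rw [h.norm_modConj, h.dual.norm_modConj]

theorem antipodeUnitary_apply (h : StandardPair V e e') (ξ : H) :
    h.antipodeUnitary ξ = V.modConj e e' (V.dual.modConj e' e ξ) := rfl

/-- On `Ŝ` one may take `ω = ω_{ξ,ê}`. Then `L(ω) e = n^(-1/2) Ĵ ξ`, which `J Ĵ` sends to `n^(-1/2)
J ξ`, and this is the slice of `V*` at `ê ⊗ e`. -/
theorem isAntipodeUnitary (h : StandardPair V e e') :
    V.IsAntipodeUnitary e h.antipodeUnitary := by
  intro ω
  obtain ⟨ξ, hξ⟩ := h.exists_vecForm_hat ω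
  have h1 : V.L ω = V.L (vecForm ξ e') := sliceLeft_congr V.op_mem hξ
  have h2 : sliceLeft ω V.opStar = sliceLeft (vecForm ξ e') V.opStar :=
    sliceLeft_congr V.one_mem_and_opStar_mem.2 hξ
  rw [h1, h2, h.L_vecForm_cofixed_apply, map_smul, antipodeUnitary_apply,
    h.dual.modConj_modConj]
  refine ext_inner_left ℂ fun ζ => ?_
  rw [inner_sliceLeft, h.inner_opStar_cofixed_fixed, inner_smul_right]

theorem antipodeUnitary_unique (h : StandardPair V e e') {U : H ≃ₗᵢ[ℂ] H}
    (hU : V.IsAntipodeUnitary e U) : U = h.antipodeUnitary := by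
  refine LinearIsometryEquiv.ext fun ξ => ?_
  obtain ⟨_, ⟨ω, rfl⟩, rfl⟩ := h.exists_apply_eq ξ
  rw [hU ω, h.isAntipodeUnitary ω]

theorem dual_antipodeUnitary (h : StandardPair V e e') :
    h.dual.antipodeUnitary = h.antipodeUnitary := by
  refine LinearIsometryEquiv.ext fun ξ => ?_
  rw [antipodeUnitary_apply, antipodeUnitary_apply, h.modConj_comm, dual_dual]

theorem antipodeUnitary_antipodeUnitary (h : StandardPair V e e') (ξ : H) :
    h.antipodeUnitary (h.antipodeUnitary ξ) = ξ := h.antipodeUnitary.left_inv ξ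

end StandardPair

/-! ### The antipode as an anti-automorphism of `L(H)`. -/

/-- The map `T ↦ Ĵ T* Ĵ`, which extends the antipode of `S` to `L(H)`. -/
def antipode (V : MultiplicativeUnitary H) (e e' : H) (T : Module.End ℂ H) : Module.End ℂ H where
  toFun ξ := V.dual.modConj e' e (LinearMap.adjoint T (V.dual.modConj e' e ξ))
  map_add' ξ η := by rw [map_add, map_add, map_add]
  map_smul' r ξ := by rw [map_smulₛₗ, map_smul, map_smulₛₗ, Complex.conj_conj, RingHom.id_apply]

theorem antipode_apply (V : MultiplicativeUnitary H) (e e' : H) (T : Module.End ℂ H) (ξ : H) :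
    V.antipode e e' T ξ =
      V.dual.modConj e' e (LinearMap.adjoint T (V.dual.modConj e' e ξ)) := rfl

namespace StandardPair

variable {V : MultiplicativeUnitary H} {e e' : H}

theorem adjoint_antipode (h : StandardPair V e e') (T : Module.End ℂ H) :
    LinearMap.adjoint (V.antipode e e' T) = V.antipode e e' (LinearMap.adjoint T) := by
  refine end_ext_inner fun ξ η => ?_
  rw [LinearMap.adjoint_inner_right, antipode_apply, antipode_apply, LinearMap.adjoint_adjoint,
    h.dual.inner_modConj_left, LinearMap.adjoint_inner_right, h.dual.inner_modConj_right]

theorem antipode_antipode (h : StandardPair V e e') (T : Module.End ℂ H) :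
    V.antipode e e' (V.antipode e e' T) = T := by
  refine LinearMap.ext fun ξ => ?_
  rw [antipode_apply, h.adjoint_antipode, antipode_apply, LinearMap.adjoint_adjoint,
    h.dual.modConj_modConj, h.dual.modConj_modConj]

theorem antipode_mul (h : StandardPair V e e') (S T : Module.End ℂ H) :
    V.antipode e e' (S * T) = V.antipode e e' T * V.antipode e e' S := by
  refine LinearMap.ext fun ξ => ?_
  rw [Module.End.mul_apply, antipode_apply, antipode_apply, antipode_apply,
    h.dual.modConj_modConj, Module.End.mul_eq_comp, LinearMap.adjoint_comp]
  rfl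

theorem antipode_one (h : StandardPair V e e') : V.antipode e e' 1 = 1 := by
  have h2 : LinearMap.adjoint (1 : Module.End ℂ H) = 1 := LinearMap.adjoint_id
  refine LinearMap.ext fun ξ => ?_
  rw [antipode_apply, h2, Module.End.one_apply, h.dual.modConj_modConj, Module.End.one_apply]

theorem antipode_mem (h : StandardPair V e e') {x : Module.End ℂ H} (hx : x ∈ V.spaceS) :
    V.antipode e e' x ∈ V.spaceS := by
  have h1 : V.antipode e e' x =
      V.ofVec e' (V.dual.modConj e' e (LinearMap.adjoint x e)) := by
    refine LinearMap.ext fun ξ => ?_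
    rw [antipode_apply]
    conv_rhs => rw [← h.dual.modConj_modConj ξ, ← h.modConj_dual_ofVec,
      h.ofVec_apply_of_mem (V.adjoint_mem_spaceS hx)]
  rw [h1]
  exact V.ofVec_mem _ _

theorem antipode_mem_iff (h : StandardPair V e e') {x : Module.End ℂ H} :
    V.antipode e e' x ∈ V.spaceS ↔ x ∈ V.spaceS := by
  refine ⟨fun hx => ?_, h.antipode_mem⟩
  rw [← h.antipode_antipode x]
  exact h.antipode_mem hx

theorem antipode_apply_fixed (h : StandardPair V e e') {x : Module.End ℂ H}
    (hx : x ∈ V.spaceS) : V.antipode e e' x e = h.antipodeUnitary (x e) := by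
  rw [antipode_apply, h.dual.modConj_cofixed, ← h.modConj_apply_of_mem hx,
    antipodeUnitary_apply, h.modConj_comm]

end StandardPair

end MultiplicativeUnitary

/-! ### Invariant vectors, their projections, and pre-subgroups. -/

namespace MultiplicativeUnitary

open MultUnitary

variable {H : Type*} [NormedAddCommGroup H] [InnerProductSpace ℂ H] [FiniteDimensional ℂ H]

/-- Against `ω` with `x = L(ω)`, the product is `⟨ξ ⊗ ξ', V (x ⊗ 1) V* (η ⊗ η')⟩`; invariance of
both tensors removes `V` and `V*`. -/
theorem rho_mul_rho_of_invariant (V : MultiplicativeUnitary H) {ξ ξ' η η' : H}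
    (hξ : V.op (ξ ⊗ₜ[ℂ] ξ') = ξ ⊗ₜ[ℂ] ξ') (hη : V.op (η ⊗ₜ[ℂ] η') = η ⊗ₜ[ℂ] η') :
    V.rho (vecForm ξ η) * V.rho (vecForm ξ' η') =
      (inner ℂ ξ' η' : ℂ) • V.rho (vecForm ξ η) := by
  refine end_ext_dual fun ω => ?_
  have h1 : dualTensor (vecForm ξ η) (vecForm ξ' η') (V.comul (V.L ω)) =
      inner ℂ ξ' (sliceLeft (vecForm ξ η) (V.comul (V.L ω)) η') := rfl
  rw [apply_rho_mul_rho, h1, inner_sliceLeft, comul, Module.End.mul_apply, Module.End.mul_apply,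
    V.opStar_eq_self hη, ← inner_opStar_left, V.opStar_eq_self hξ, TensorProduct.map_tmul,
    TensorProduct.inner_tmul, map_smul, ← apply_L, vecForm_apply, smul_eq_mul, mul_comm,
    Module.End.one_apply]

theorem adjoint_L_vecForm (V : MultiplicativeUnitary H) (ξ η : H) :
    LinearMap.adjoint (V.L (vecForm ξ η)) = V.dual.rho (vecForm η ξ) := by
  have := V.dual.adjoint_dual_L_vecForm ξ η
  rwa [dual_dual] at this

theorem L_mul_L_of_invariant (V : MultiplicativeUnitary H) {ξ ξ' η η' : H}
    (hξ : V.op (ξ ⊗ₜ[ℂ] ξ') = ξ ⊗ₜ[ℂ] ξ') (hη : V.op (η ⊗ₜ[ℂ] η') = η ⊗ₜ[ℂ] η') :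
    V.L (vecForm ξ η) * V.L (vecForm ξ' η') = (inner ℂ ξ η : ℂ) • V.L (vecForm ξ' η') := by
  have h := V.dual.rho_mul_rho_of_invariant ((V.dual_op_tmul_eq_iff _ _).2 hη)
    ((V.dual_op_tmul_eq_iff _ _).2 hξ)
  rw [← adjoint_L_vecForm, ← adjoint_L_vecForm] at h
  have h2 := congrArg LinearMap.adjoint h
  rw [Module.End.mul_eq_comp, LinearMap.adjoint_comp, map_smulₛₗ, LinearMap.adjoint_adjoint,
    LinearMap.adjoint_adjoint, inner_conj_symm] at h2
  exact h2

/-- The operator `ρ(ω_{f,f})`; for an invariant unit vector `f`, it is the orthogonal projection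
onto `H_f`. -/
def lowerProj (V : MultiplicativeUnitary H) (f : H) : Module.End ℂ H := V.rho (vecForm f f)

theorem lowerProj_mem (V : MultiplicativeUnitary H) (f : H) : V.lowerProj f ∈ V.spaceSHat :=
  V.rho_mem _

/-- Unit vectors `f` with `V(f ⊗ f) = f ⊗ f`. -/
structure IsInvariant (V : MultiplicativeUnitary H) (f : H) : Prop where
  norm_eq : ‖f‖ = 1
  op_eq : V.op (f ⊗ₜ[ℂ] f) = f ⊗ₜ[ℂ] f

namespace IsInvariant

variable {V : MultiplicativeUnitary H} {f : H}

theorem inner_self (hf : V.IsInvariant f) : (inner ℂ f f : ℂ) = 1 := by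
  rw [inner_self_eq_norm_sq_to_K, hf.norm_eq]; simp

theorem dual (hf : V.IsInvariant f) : V.dual.IsInvariant f :=
  ⟨hf.norm_eq, (V.dual_op_tmul_eq_iff f f).2 hf.op_eq⟩

theorem lowerProj_mul_self (hf : V.IsInvariant f) :
    V.lowerProj f * V.lowerProj f = V.lowerProj f := by
  rw [lowerProj, V.rho_mul_rho_of_invariant hf.op_eq hf.op_eq, hf.inner_self, one_smul]

theorem norm_lowerProj_le (hf : V.IsInvariant f) (x : H) : ‖V.lowerProj f x‖ ≤ ‖x‖ := by
  have h1 : ‖(inner ℂ (V.lowerProj f x) (V.lowerProj f x) : ℂ)‖ ≤ ‖V.lowerProj f x‖ * ‖x‖ := by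
    conv_lhs => enter [1, 3]; rw [lowerProj]
    rw [inner_rho]
    refine (norm_inner_le_norm (𝕜 := ℂ) (E := H ⊗[ℂ] H) _ _).trans ?_
    simp [norm_op, hf.norm_eq]
  rw [inner_self_eq_norm_sq_to_K] at h1
  have h4 : ‖V.lowerProj f x‖ ^ 2 ≤ ‖V.lowerProj f x‖ * ‖x‖ := by simpa using h1
  rcases (norm_nonneg (V.lowerProj f x)).eq_or_lt with h0 | h0
  · rw [← h0]; exact norm_nonneg x
  · rw [sq] at h4
    exact le_of_mul_le_mul_left h4 h0

theorem adjoint_lowerProj (hf : V.IsInvariant f) :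
    LinearMap.adjoint (V.lowerProj f) = V.lowerProj f :=
  adjoint_eq_of_idempotent_contraction hf.lowerProj_mul_self hf.norm_lowerProj_le

theorem lowerProj_apply_eq_iff (hf : V.IsInvariant f) {η : H} :
    V.lowerProj f η = η ↔ η ∈ V.lowerSpace f := by
  constructor
  · intro h
    refine V.op_eq_self_of_inner ?_
    rw [← inner_rho]
    change (inner ℂ η (V.lowerProj f η) : ℂ).re = _
    rw [h, inner_self_eq_norm_sq_to_K, TensorProduct.norm_tmul, hf.norm_eq, mul_one]
    norm_cast
  · intro h
    have h' : V.op (η ⊗ₜ[ℂ] f) = η ⊗ₜ[ℂ] f := h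
    refine ext_inner_left ℂ fun ζ => ?_
    rw [lowerProj, inner_rho, h', TensorProduct.inner_tmul, hf.inner_self, mul_one]

theorem lowerProj_apply_mem (hf : V.IsInvariant f) (η : H) :
    V.lowerProj f η ∈ V.lowerSpace f :=
  hf.lowerProj_apply_eq_iff.1 (LinearMap.congr_fun hf.lowerProj_mul_self η)

theorem L_vecForm_self (hf : V.IsInvariant f) : V.L (vecForm f f) = V.dual.lowerProj f := by
  rw [← hf.dual.adjoint_lowerProj, lowerProj, ← adjoint_L_vecForm, LinearMap.adjoint_adjoint]

theorem lowerProj_eq_of_lowerSpace_eq (hf : V.IsInvariant f) {f' : H} (hf' : V.IsInvariant f')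
    (h : V.lowerSpace f = V.lowerSpace f') : V.lowerProj f = V.lowerProj f' := by
  have h1 : V.lowerProj f' * V.lowerProj f = V.lowerProj f := LinearMap.ext fun η =>
    hf'.lowerProj_apply_eq_iff.2 (h ▸ hf.lowerProj_apply_mem η)
  have h2 : V.lowerProj f * V.lowerProj f' = V.lowerProj f' := LinearMap.ext fun η =>
    hf.lowerProj_apply_eq_iff.2 (h ▸ hf'.lowerProj_apply_mem η)
  have h3 := congrArg LinearMap.adjoint h1
  rw [Module.End.mul_eq_comp, LinearMap.adjoint_comp, hf.adjoint_lowerProj,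
    hf'.adjoint_lowerProj] at h3
  exact h3.symm.trans h2

end IsInvariant

namespace StandardPair

variable {V : MultiplicativeUnitary H} {e e' f : H}

/-- An invariant vector is proportional to the projection of `e` onto `H^f`. -/
theorem smul_eq_smul_dual_lowerProj (h : StandardPair V e e') (hf : V.IsInvariant f) :
    (normScalar H : ℂ) • f = (inner ℂ e' f : ℂ) • V.dual.lowerProj f e := by
  set a := V.dual.lowerProj f with ha
  have haL : V.L (vecForm f f) = a := hf.L_vecForm_self
  have ha_adj : LinearMap.adjoint a = a := hf.dual.adjoint_lowerProj
  have ha_mem : a ∈ V.spaceS := haL ▸ V.L_mem _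
  -- `h1` and `h2` together give `L(ω_{f,ê}) = ⟨f, ê⟩ a`: take adjoints in `h1` and compare.
  have h1 : a * V.L (vecForm f e') = V.L (vecForm f e') := by
    rw [← haL, V.L_mul_L_of_invariant hf.op_eq (h.cofixed f), hf.inner_self, one_smul]
  have h2 : LinearMap.adjoint (V.L (vecForm f e')) * a = (inner ℂ e' f : ℂ) • a := by
    refine end_ext_inner fun ζ θ => ?_
    have hθ : V.op (f ⊗ₜ[ℂ] a θ) = f ⊗ₜ[ℂ] a θ :=
      (V.dual_op_tmul_eq_iff (a θ) f).1 (hf.dual.lowerProj_apply_mem θ)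
    rw [Module.End.mul_apply, LinearMap.adjoint_inner_right, ← inner_conj_symm, inner_L,
      ← inner_opStar_left, V.opStar_eq_self hθ, TensorProduct.inner_tmul, map_mul,
      inner_conj_symm, inner_conj_symm, LinearMap.smul_apply, inner_smul_right]
  have h3 : V.L (vecForm f e') = (inner ℂ f e' : ℂ) • a := by
    have h4 := congrArg LinearMap.adjoint h1
    rw [Module.End.mul_eq_comp, LinearMap.adjoint_comp, ha_adj, ← Module.End.mul_eq_comp, h2]
      at h4
    have h5 := congrArg LinearMap.adjoint h4
    rw [LinearMap.adjoint_adjoint, map_smulₛₗ, ha_adj, inner_conj_symm] at h5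
    exact h5.symm
  -- `a` is self-adjoint and fixed by the antipode, so `a e` is fixed by `J` and by `U = J Ĵ`, hence
  -- by `Ĵ`. Since `L(ω_{f,ê}) e = n^(-1/2) Ĵ f`, applying `Ĵ` recovers `f`.
  have hJ : V.modConj e e' (a e) = a e := by rw [h.modConj_apply_of_mem ha_mem, ha_adj]
  have hU : h.antipodeUnitary (a e) = a e := by
    rw [← haL, h.isAntipodeUnitary, ← dual_rho, haL]
    rfl
  have hJh : V.dual.modConj e' e (a e) = a e := by
    rwa [antipodeUnitary_apply, h.modConj_comm, hJ] at hU
  have h6 := h.L_vecForm_cofixed_apply f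
  rw [h3, LinearMap.smul_apply] at h6
  have h7 := congrArg (V.dual.modConj e' e) h6
  rw [map_smulₛₗ, map_smulₛₗ, hJh, h.dual.modConj_modConj, Complex.conj_ofReal,
    inner_conj_symm] at h7
  exact h7.symm

theorem smul_eq_smul_lowerProj (h : StandardPair V e e') (hf : V.IsInvariant f) :
    (normScalar H : ℂ) • f = (inner ℂ e f : ℂ) • V.lowerProj f e' := by
  have := h.dual.smul_eq_smul_dual_lowerProj hf.dual
  rwa [dual_dual] at this

end StandardPair

theorem mem_preSubgroups_iff (V : MultiplicativeUnitary H) {e f : H} :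
    f ∈ V.preSubgroups e ↔ V.IsInvariant f ∧ ∃ r : ℝ, 0 < r ∧ inner ℂ e f = (r : ℂ) := by
  constructor
  · rintro ⟨h1, ⟨h2, h3⟩, h4⟩
    refine ⟨⟨h1, h4⟩, _, h2, ?_⟩
    rw [← inner_conj_symm, Complex.conj_eq_iff_im.2 h3]
    exact Complex.ext (by simp) (by simp [h3])
  · rintro ⟨hf, r, hr, h⟩
    have h' : inner ℂ f e = (r : ℂ) := by rw [← inner_conj_symm, h, Complex.conj_ofReal]
    exact ⟨hf.norm_eq, by simp [h', hr], hf.op_eq⟩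

namespace StandardPair

variable {V : MultiplicativeUnitary H} {e e' f : H}

/-- Pairing `n^(-1/2) f = ⟨e, f⟩ p_f ê` with `ê` gives `n^(-1/2) ⟨ê, f⟩ = ⟨e, f⟩ ‖p_f ê‖²`, so
positivity against `e` passes to `ê`, and back by duality. -/
theorem dual_preSubgroups (h : StandardPair V e e') :
    V.dual.preSubgroups e' = V.preSubgroups e := by
  have key : ∀ {V : MultiplicativeUnitary H} {e e' : H}, StandardPair V e e' →
      V.preSubgroups e ⊆ V.dual.preSubgroups e' := by
    intro V e e' h f hf
    obtain ⟨hf, r, hr, hfe⟩ := V.mem_preSubgroups_iff.1 hf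
    refine V.dual.mem_preSubgroups_iff.2
      ⟨hf.dual, (normScalar H)⁻¹ * (r * ‖V.lowerProj f e'‖ ^ 2), ?_, ?_⟩
    · have h0 : V.lowerProj f e' ≠ 0 := by
        intro h0
        have := h.smul_eq_smul_lowerProj hf
        rw [h0, smul_zero, smul_eq_zero_iff_right h.normScalar_ne_zero] at this
        have h1 := hf.norm_eq
        rw [this, norm_zero] at h1
        exact zero_ne_one h1
      have := h.normScalar_pos
      have := norm_pos_iff.2 h0
      positivity
    · have h1 := congrArg (fun x => (inner ℂ e' x : ℂ)) (h.smul_eq_smul_lowerProj hf)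
      simp only [inner_smul_right, hfe] at h1
      have h2 : (inner ℂ e' (V.lowerProj f e') : ℂ) = (‖V.lowerProj f e'‖ : ℂ) ^ 2 := by
        have h3 := inner_self_eq_norm_sq_to_K (𝕜 := ℂ) (V.lowerProj f e')
        rw [← LinearMap.adjoint_inner_right, hf.adjoint_lowerProj] at h3
        rw [← Module.End.mul_apply, hf.lowerProj_mul_self] at h3
        exact h3
      rw [h2] at h1
      push_cast
      rw [eq_inv_mul_iff_mul_eq₀ h.normScalar_ne_zero, h1]
  refine Set.Subset.antisymm ?_ (key h)
  have := key h.dual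
  rwa [dual_dual] at this

/-- `f` is a real multiple of `q e`, with `q` the projection onto `H^f`, a self-adjoint element of
`S`. -/
theorem modConj_eq_self (h : StandardPair V e e') (hf : f ∈ V.preSubgroups e) :
    V.modConj e e' f = f := by
  have hf' := hf
  rw [← h.dual_preSubgroups] at hf'
  obtain ⟨hi, -⟩ := V.mem_preSubgroups_iff.1 hf
  obtain ⟨-, r, -, hr⟩ := V.dual.mem_preSubgroups_iff.1 hf'
  have h1 := h.smul_eq_smul_dual_lowerProj hi
  have h2 := congrArg (V.modConj e e') h1
  have ha_mem : V.dual.lowerProj f ∈ V.spaceS := hi.L_vecForm_self ▸ V.L_mem _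
  rw [map_smulₛₗ, map_smulₛₗ, h.modConj_apply_of_mem ha_mem, hi.dual.adjoint_lowerProj, hr,
    Complex.conj_ofReal, Complex.conj_ofReal, ← hr, ← h1] at h2
  exact smul_right_injective H h.normScalar_ne_zero h2

/-- Both are unit vectors and positive multiples of the same vector `p_f ê`. -/
theorem eq_of_lowerSpace_eq (h : StandardPair V e e') {f' : H} (hf : f ∈ V.preSubgroups e)
    (hf' : f' ∈ V.preSubgroups e) (hff : V.lowerSpace f = V.lowerSpace f') : f = f' := by
  obtain ⟨hi, r, hr, hre⟩ := V.mem_preSubgroups_iff.1 hf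
  obtain ⟨hi', r', hr', hre'⟩ := V.mem_preSubgroups_iff.1 hf'
  have h1 := h.smul_eq_smul_lowerProj hi
  have h2 := h.smul_eq_smul_lowerProj hi'
  rw [← hi.lowerProj_eq_of_lowerSpace_eq hi' hff, hre'] at h2
  rw [hre] at h1
  have n1 := congrArg norm h1
  have n2 := congrArg norm h2
  rw [norm_smul, norm_smul, hi.norm_eq, Complex.norm_real, Complex.norm_real, Real.norm_eq_abs,
    Real.norm_eq_abs, abs_of_pos hr, abs_of_pos h.normScalar_pos] at n1
  rw [norm_smul, norm_smul, hi'.norm_eq, Complex.norm_real, Complex.norm_real, Real.norm_eq_abs,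
    Real.norm_eq_abs, abs_of_pos hr', abs_of_pos h.normScalar_pos, n1] at n2
  have hv : ‖V.lowerProj f e'‖ ≠ 0 := by
    intro h0
    rw [h0, mul_zero, mul_one] at n1
    exact h.normScalar_pos.ne' n1
  rw [← mul_right_cancel₀ hv n2, ← h1] at h2
  exact smul_right_injective H h.normScalar_ne_zero h2.symm

/-- `p_f` is the element of `Ŝ` attached to `p_f ê`, a real multiple of `f` and so fixed by `J`; now
`J y_ξ J = y_{Jξ}` from `modConj_ofVec_dual`. This is what makes coideals involutive. -/
theorem modConj_lowerProj (h : StandardPair V e e') (hf : f ∈ V.preSubgroups e) (θ : H) :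
    V.modConj e e' (V.lowerProj f θ) = V.lowerProj f (V.modConj e e' θ) := by
  obtain ⟨hi, r, hr, hre⟩ := V.mem_preSubgroups_iff.1 hf
  have h1 := h.smul_eq_smul_lowerProj hi
  have h2 := congrArg (V.modConj e e') h1
  rw [hre] at h1 h2
  rw [map_smulₛₗ, map_smulₛₗ, h.modConj_eq_self hf, Complex.conj_ofReal, Complex.conj_ofReal,
    h1] at h2
  have hr0 : (r : ℂ) ≠ 0 := by exact_mod_cast hr.ne'
  have h3 : V.modConj e e' (V.lowerProj f e') = V.lowerProj f e' :=
    (smul_right_injective H hr0 h2).symm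
  have h4 : V.dual.ofVec e (V.lowerProj f e') = V.lowerProj f :=
    h.dual.ofVec_apply_of_mem (by rw [dual_spaceS]; exact V.lowerProj_mem f)
  have h5 := h.modConj_ofVec_dual (V.lowerProj f e') θ
  rwa [h3, h4] at h5

theorem modConj_mem_lowerSpace (h : StandardPair V e e') (hf : f ∈ V.preSubgroups e) {η : H}
    (hη : η ∈ V.lowerSpace f) : V.modConj e e' η ∈ V.lowerSpace f := by
  obtain ⟨hi, -⟩ := V.mem_preSubgroups_iff.1 hf
  rw [← hi.lowerProj_apply_eq_iff] at hη ⊢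
  rw [← h.modConj_lowerProj hf, hη]

end StandardPair

end MultiplicativeUnitary

/-! ### Coideal subalgebras of `S`. -/

namespace MultiplicativeUnitary

open MultUnitary

variable {H : Type*} [NormedAddCommGroup H] [InnerProductSpace ℂ H] [FiniteDimensional ℂ H]

theorem mem_G_iff (V : MultiplicativeUnitary H) {e f : H} {x : Module.End ℂ H} :
    x ∈ V.G e f ↔ x ∈ V.spaceS ∧ x e ∈ V.lowerSpace f := Iff.rfl

namespace StandardPair

variable {V : MultiplicativeUnitary H} {e e' f : H}

/-- Under `S ≅ S e`, the operator `J y J` is right multiplication by `y*`, which commutes with left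
multiplication by `x`. -/
theorem modConj_conj_comm (h : StandardPair V e e') {x y : Module.End ℂ H} (hx : x ∈ V.spaceS)
    (hy : y ∈ V.spaceS) (η : H) :
    x (V.modConj e e' (y (V.modConj e e' η))) = V.modConj e e' (y (V.modConj e e' (x η))) := by
  have key : ∀ z ∈ V.spaceS,
      V.modConj e e' (y (V.modConj e e' (z e))) = z (LinearMap.adjoint y e) := by
    intro z hz
    have := h.modConj_apply_of_mem (V.spaceS_mul y hy _ (V.adjoint_mem_spaceS hz))
    rw [h.modConj_apply_of_mem hz, ← Module.End.mul_apply, this, Module.End.mul_eq_comp,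
      LinearMap.adjoint_comp, LinearMap.adjoint_adjoint, LinearMap.comp_apply]
  obtain ⟨z, hz, rfl⟩ := h.exists_apply_eq η
  rw [key z hz, ← Module.End.mul_apply, ← Module.End.mul_apply x z, key _ (V.spaceS_mul x hx z hz)]

/-- The condition on the right says that `B e` is stable under `Ĵ Ŝ Ĵ`. Slicing `δ(x)` by `ω_{ξ,e}`
gives `L(ω_{ξ,xe})`, which `L_vecForm_apply` evaluates, and such forms exhaust the dual of `S`. -/
theorem leftCoideal_iff (h : StandardPair V e e') {B : Submodule ℂ (Module.End ℂ H)}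
    (hB : B ≤ V.spaceS) :
    (∀ x ∈ B, V.comul x ∈ tensorSpan V.spaceS B) ↔
      ∀ x ∈ B, ∀ ξ, V.ofVec e'
        (V.dual.modConj e' e (V.dual.ofVec e ξ (V.dual.modConj e' e (x e)))) ∈ B := by
  have h1 : ∀ x ξ, sliceLeft (vecForm ξ e) (V.comul x) = (normScalar H : ℂ) • V.ofVec e'
      (V.dual.modConj e' e (V.dual.ofVec e ξ (V.dual.modConj e' e (x e)))) := by
    intro x ξ
    rw [← map_smul, ← h.L_vecForm_apply, h.ofVec_apply_of_mem (V.L_mem _)]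
    refine end_ext_inner fun ζ θ => ?_
    rw [inner_sliceLeft, V.comul_fixed h.fixed, inner_L]
  refine forall₂_congr fun x hx => ⟨fun hT ξ => ?_, fun hT => ?_⟩
  · have h2 := sliceLeft_mem hT (vecForm ξ e)
    rw [h1] at h2
    have h3 := B.smul_mem (normScalar H : ℂ)⁻¹ h2
    rwa [inv_smul_smul₀ h.normScalar_ne_zero] at h3
  · have hS := V.comul_mem (hB hx)
    refine mem_tensorSpan _ (fun ω => ?_) (fun ω => sliceRight_mem hS ω)
    obtain ⟨ξ, hξ⟩ := h.exists_vecForm ω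
    rw [sliceLeft_congr hS hξ, h1]
    exact B.smul_mem _ (hT ξ)

/-- Here the condition is stability of `B e` under `Ŝ`: the right slice of `δ(x)` by `ω` sends `e`
to `ρ(ω) x e`. -/
theorem rightCoideal_iff (h : StandardPair V e e') {B : Submodule ℂ (Module.End ℂ H)}
    (hB : B ≤ V.spaceS) :
    (∀ x ∈ B, V.comul x ∈ tensorSpan B V.spaceS) ↔
      ∀ x ∈ B, ∀ ξ, V.ofVec e' (V.dual.ofVec e ξ (x e)) ∈ B := by
  have h1 : ∀ x ∈ B, ∀ ω, sliceRight ω (V.comul x) = V.ofVec e' (V.rho ω (x e)) := by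
    intro x hx ω
    rw [← h.ofVec_apply_of_mem (sliceRight_mem (V.comul_mem (hB hx)) ω)]
    congr 1
    refine ext_inner_left ℂ fun ζ => ?_
    rw [← vecForm_apply ζ e, ← apply_sliceLeft, ← vecForm_apply ζ (x e), ← apply_L]
    congr 1
    refine end_ext_inner fun ζ θ => ?_
    rw [inner_sliceLeft, V.comul_fixed h.fixed, inner_L]
  refine forall₂_congr fun x hx => ⟨fun hT ξ => ?_, fun hT => ?_⟩
  · have hξ := V.dual.ofVec_mem e ξ
    rw [dual_spaceS] at hξ
    obtain ⟨ω, hω⟩ := hξ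
    have h2 := sliceRight_mem hT ω
    rwa [h1 x hx, hω] at h2
  · have hS := V.comul_mem (hB hx)
    refine mem_tensorSpan _ (fun ω => sliceLeft_mem hS ω) (fun ω => ?_)
    have hω : V.rho ω ∈ V.dual.spaceS := by rw [dual_spaceS]; exact V.rho_mem ω
    rw [h1 x hx, ← h.dual.ofVec_apply_of_mem hω]
    exact hT _

theorem tensorSpan_apply (h : StandardPair V e e') {Q : Submodule ℂ (Module.End ℂ H)}
    {T : Module.End ℂ (H ⊗[ℂ] H)} (hT : T ∈ tensorSpan V.spaceS Q) (ζ f : H) :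
    T (ζ ⊗ₜ[ℂ] f) =
      TensorProduct.map (LinearMap.applyₗ ζ ∘ₗ V.ofVec e') (1 : Module.End ℂ H)
        (T (e ⊗ₜ[ℂ] f)) := by
  refine Submodule.span_induction (p := fun T _ => T (ζ ⊗ₜ[ℂ] f) =
      TensorProduct.map (LinearMap.applyₗ ζ ∘ₗ V.ofVec e') (1 : Module.End ℂ H)
        (T (e ⊗ₜ[ℂ] f))) ?_ ?_ ?_ ?_ hT
  · rintro _ ⟨a, ha, b, -, rfl⟩
    rw [TensorProduct.map_tmul, TensorProduct.map_tmul, TensorProduct.map_tmul,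
      LinearMap.comp_apply, h.ofVec_apply_of_mem ha]
    rfl
  · simp
  · intro x y _ _ hx hy
    rw [LinearMap.add_apply, LinearMap.add_apply, map_add, hx, hy]
  · intro r x _ hx
    rw [LinearMap.smul_apply, LinearMap.smul_apply, map_smul, hx]

/-- `δ(x)(e ⊗ f) = x e ⊗ f` forces `δ(x)(ζ ⊗ f) = x ζ ⊗ f` for every `ζ`, as elements of `S` are
determined by their values at `e`. At `ζ = y e` the factor `V*` in `δ(x)` disappears. -/
theorem mul_mem_G (h : StandardPair V e e') {x y : Module.End ℂ H} (hx : x ∈ V.G e f)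
    (hy : y ∈ V.G e f) : x * y ∈ V.G e f := by
  obtain ⟨hxS, hxf⟩ := V.mem_G_iff.1 hx
  obtain ⟨hyS, hyf⟩ := V.mem_G_iff.1 hy
  refine V.mem_G_iff.2 ⟨V.spaceS_mul x hxS y hyS, ?_⟩
  have hx' : V.op (x e ⊗ₜ[ℂ] f) = x e ⊗ₜ[ℂ] f := hxf
  have hy' : V.op (y e ⊗ₜ[ℂ] f) = y e ⊗ₜ[ℂ] f := hyf
  have h1 : V.comul x (y e ⊗ₜ[ℂ] f) = x (y e) ⊗ₜ[ℂ] f := by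
    rw [h.tensorSpan_apply (V.comul_mem hxS), V.comul_fixed h.fixed, hx', TensorProduct.map_tmul,
      LinearMap.comp_apply, h.ofVec_apply_of_mem hxS]
    rfl
  change V.op (x (y e) ⊗ₜ[ℂ] f) = x (y e) ⊗ₜ[ℂ] f
  have h2 : V.comul x (y e ⊗ₜ[ℂ] f) = V.op (x (y e) ⊗ₜ[ℂ] f) := by
    rw [comul, Module.End.mul_apply, Module.End.mul_apply, V.opStar_eq_self hy',
      TensorProduct.map_tmul, Module.End.one_apply]
  rw [← h2, h1]

theorem fixed_mem_lowerSpace (h : StandardPair V e e') (f : H) : e ∈ V.lowerSpace f := h.fixed f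

/-- The subalgebra `G_f`. -/
def subalgebraG (h : StandardPair V e e') (f : H) : Subalgebra ℂ (Module.End ℂ H) where
  carrier := V.G e f
  mul_mem' := h.mul_mem_G
  add_mem' := (V.G e f).add_mem
  algebraMap_mem' r := by
    rw [Algebra.algebraMap_eq_smul_one]
    exact (V.G e f).smul_mem r (V.mem_G_iff.2 ⟨V.one_mem_spaceS, h.fixed_mem_lowerSpace f⟩)

/-- `p_f` belongs to `Ŝ`, so it commutes with `Ĵ Ŝ Ĵ`, and its range `H_f` is stable under that
algebra. -/
theorem isLeftCoideal_subalgebraG (h : StandardPair V e e') (hf : V.IsInvariant f) :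
    V.IsLeftCoideal (h.subalgebraG f) := by
  refine ⟨fun x hx => (V.mem_G_iff.1 hx).1, ?_⟩
  refine (h.leftCoideal_iff (B := V.G e f) inf_le_left).2 fun x hx ξ => ?_
  obtain ⟨hxS, hxf⟩ := V.mem_G_iff.1 hx
  refine V.mem_G_iff.2 ⟨V.ofVec_mem _ _, ?_⟩
  rw [h.ofVec_apply]
  rw [← hf.lowerProj_apply_eq_iff] at hxf ⊢
  have hm : V.lowerProj f ∈ V.dual.spaceS := by rw [dual_spaceS]; exact V.lowerProj_mem f
  rw [h.dual.modConj_conj_comm hm (V.dual.ofVec_mem _ _), hxf]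

/-- The counit of `S` is `x ↦ ⟨ê, x ê⟩`: `ê` is an eigenvector of `x*`. -/
theorem inner_cofixed_apply (h : StandardPair V e e') {x : Module.End ℂ H} (hx : x ∈ V.spaceS)
    (η : H) : (inner ℂ e' (x η) : ℂ) = inner ℂ e' (x e') * inner ℂ e' η := by
  obtain ⟨ω, hω⟩ := V.adjoint_mem_spaceS hx
  have h1 : LinearMap.adjoint x e' = ω 1 • e' := by rw [← hω, V.L_apply_cofixed h.cofixed]
  rw [← LinearMap.adjoint_inner_left, ← LinearMap.adjoint_inner_left x, h1, inner_smul_left,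
    inner_smul_left, inner_self_eq_norm_sq_to_K, h.norm_cofixed]
  simp

theorem sliceRight_cofixed_comul (h : StandardPair V e e') (x : Module.End ℂ H) :
    sliceRight (vecForm e' e') (V.comul x) = x := by
  refine end_ext_inner fun ζ θ => ?_
  rw [inner_sliceRight, comul, Module.End.mul_apply, Module.End.mul_apply,
    V.opStar_cofixed h.cofixed, ← inner_opStar_left, V.opStar_cofixed h.cofixed,
    TensorProduct.map_tmul, TensorProduct.inner_tmul, Module.End.one_apply,
    inner_self_eq_norm_sq_to_K, h.norm_cofixed]
  simp

theorem exists_preSubgroup_of_isLeftCoideal (h : StandardPair V e e')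
    {B : Subalgebra ℂ (Module.End ℂ H)} (hB : V.IsLeftCoideal B) :
    ∃ f ∈ V.preSubgroups e, V.G e f = Subalgebra.toSubmodule B := by
  set P : Submodule ℂ (Module.End ℂ H) := Subalgebra.toSubmodule B with hP
  have hPS : P ≤ V.spaceS := hB.1
  have hco : ∀ x ∈ P, V.comul x ∈ tensorSpan V.spaceS P := hB.2
  set K : Submodule ℂ H := P.map (LinearMap.applyₗ e : Module.End ℂ H →ₗ[ℂ] H) with hK
  have memK : ∀ x ∈ P, x e ∈ K := fun x hx => ⟨x, hx, rfl⟩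
  set f₀ : H := K.starProjection e' with hf₀
  have f₀K : f₀ ∈ K := K.starProjection_apply_mem e'
  obtain ⟨b, hb, hbe⟩ := f₀K
  replace hbe : b e = f₀ := hbe
  have hproj : ∀ k ∈ K, (inner ℂ f₀ k : ℂ) = inner ℂ e' k := by
    intro k hk
    have := K.starProjection_inner_eq_zero e' k hk
    rw [inner_sub_left, sub_eq_zero] at this
    exact this.symm
  have he_f₀ : (inner ℂ e f₀ : ℂ) = (normScalar H : ℂ) := by
    have h1 := hproj e (memK 1 B.one_mem)
    rw [h.inner_eq'] at h1
    rw [← inner_conj_symm, h1, Complex.conj_ofReal]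
  have hf₀0 : f₀ ≠ 0 := by
    intro h0
    rw [h0, inner_zero_right] at he_f₀
    exact h.normScalar_ne_zero he_f₀.symm
  have hlow : ∀ x ∈ P, V.op (x e ⊗ₜ[ℂ] f₀) = x e ⊗ₜ[ℂ] f₀ := by
    intro x hx
    refine V.op_eq_self_of_inner ?_
    -- For `y ∈ B`, `y f₀ = y b e` stays in `K`, so `f₀` may be replaced by `ê` on the left of the
    -- inner product, where the counit comes out. This is where `B` is used as an algebra.
    have h1 : ∀ y ∈ P, vecForm f₀ f₀ y = ((inner ℂ f₀ f₀ : ℂ) • vecForm e' e') y := by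
      intro y hy
      have hyK : y f₀ ∈ K := by
        rw [← hbe]
        exact memK (y * b) (B.mul_mem hy hb)
      rw [vecForm_apply, hproj _ hyK, h.inner_cofixed_apply (hPS hy),
        hproj f₀ (hbe ▸ memK b hb), LinearMap.smul_apply, smul_eq_mul, vecForm_apply, mul_comm]
    -- By the counit axiom, the slice of `δ(x) ∈ S ⊗ B` by `ω_{f₀,f₀}` is `‖f₀‖² x`; thus `⟨x e ⊗
    -- f₀, V(x e ⊗ f₀)⟩ = ‖x e‖² ‖f₀‖²`, the equality case.
    have h2 : sliceRight ((inner ℂ f₀ f₀ : ℂ) • vecForm e' e') (V.comul x) =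
        (inner ℂ f₀ f₀ : ℂ) • x := by
      conv_rhs => rw [← h.sliceRight_cofixed_comul x]
      simp [sliceRight, LinearMap.lTensor_smul]
    rw [← V.comul_fixed h.fixed, ← inner_sliceRight, sliceRight_congr (hco x hx) h1, h2,
      LinearMap.smul_apply, inner_smul_right, inner_self_eq_norm_sq_to_K,
      inner_self_eq_norm_sq_to_K, TensorProduct.norm_tmul]
    norm_cast
    rw [mul_pow, mul_comm]
    exact Complex.ofReal_re (‖x e‖ ^ 2 * ‖f₀‖ ^ 2)
  have hr : 0 < ‖f₀‖ := norm_pos_iff.2 hf₀0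
  set f : H := ((‖f₀‖⁻¹ : ℝ) : ℂ) • f₀ with hf
  have hlow' : ∀ x ∈ P, x e ∈ V.lowerSpace f := by
    intro x hx
    change V.op (x e ⊗ₜ[ℂ] f) = x e ⊗ₜ[ℂ] f
    rw [hf, TensorProduct.tmul_smul, map_smul, hlow x hx]
  have hinv : V.IsInvariant f := by
    refine ⟨?_, ?_⟩
    · rw [hf, norm_smul, Complex.norm_real, norm_inv, norm_norm, inv_mul_cancel₀ hr.ne']
    · have := (V.lowerSpace f).smul_mem ((‖f₀‖⁻¹ : ℝ) : ℂ) (hlow' b hb)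
      rw [hbe] at this
      exact this
  have hef : (inner ℂ e f : ℂ) = ((‖f₀‖⁻¹ * normScalar H : ℝ) : ℂ) := by
    rw [hf, inner_smul_right, he_f₀, Complex.ofReal_mul]
  have hpre : f ∈ V.preSubgroups e :=
    V.mem_preSubgroups_iff.2 ⟨hinv, _, mul_pos (inv_pos.2 hr) h.normScalar_pos, hef⟩
  have hproj_e' : V.lowerProj f e' = f₀ := by
    have h1 := h.smul_eq_smul_lowerProj hinv
    rw [hef, hf, smul_smul, Complex.ofReal_mul, mul_comm] at h1
    refine (smul_right_injective H ?_ h1).symm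
    exact mul_ne_zero (by exact_mod_cast (inv_pos.2 hr).ne') h.normScalar_ne_zero
  refine ⟨f, hpre, le_antisymm (fun x hx => ?_) fun x hx => V.mem_G_iff.2 ⟨hPS hx, hlow' x hx⟩⟩
  obtain ⟨hxS, hxf⟩ := V.mem_G_iff.1 hx
  -- For `x e ∈ H_f`, take `y ∈ Ŝ` with `y ê = Ĵ(x e)`. Then `Ĵ y Ĵ` maps `f₀ = p_f ê ∈ K` to `p_f Ĵ
  -- y ê = p_f x e = x e`, and it preserves `K`.
  have h1 := (h.leftCoideal_iff hPS).1 hco b hb (V.dual.modConj e' e (x e))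
  have hm : V.lowerProj f ∈ V.dual.spaceS := by rw [dual_spaceS]; exact V.lowerProj_mem f
  rw [hbe, ← hproj_e', ← h.dual.modConj_conj_comm hm (V.dual.ofVec_mem _ _),
    h.dual.modConj_fixed, h.dual.ofVec_apply, h.dual.modConj_modConj,
    hinv.lowerProj_apply_eq_iff.2 hxf, h.ofVec_apply_of_mem hxS] at h1
  exact h1

theorem lowerSpace_eq_of_G_eq (h : StandardPair V e e') {f f' : H} (hff : V.G e f = V.G e f') :
    V.lowerSpace f = V.lowerSpace f' := by
  have key : ∀ {f f' : H}, V.G e f = V.G e f' → V.lowerSpace f ≤ V.lowerSpace f' := by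
    intro f f' hff η hη
    obtain ⟨x, hx, rfl⟩ := h.exists_apply_eq η
    have hxG : x ∈ V.G e f := V.mem_G_iff.2 ⟨hx, hη⟩
    rw [hff] at hxG
    exact (V.mem_G_iff.1 hxG).2
  exact le_antisymm (key hff) (key hff.symm)

theorem bijOn_G (h : StandardPair V e e') :
    Set.BijOn (fun f => V.G e f) (V.preSubgroups e)
      (Subalgebra.toSubmodule '' {B | V.IsLeftCoideal B}) := by
  refine ⟨fun f hf => ?_, fun f hf f' hf' hff => ?_, ?_⟩
  · exact ⟨h.subalgebraG f, h.isLeftCoideal_subalgebraG (V.mem_preSubgroups_iff.1 hf).1, rfl⟩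
  · exact h.eq_of_lowerSpace_eq hf hf' (h.lowerSpace_eq_of_G_eq hff)
  · rintro _ ⟨B, hB, rfl⟩
    exact h.exists_preSubgroup_of_isLeftCoideal hB

theorem star_mem_of_isLeftCoideal (h : StandardPair V e e')
    {B : Subalgebra ℂ (Module.End ℂ H)} (hB : V.IsLeftCoideal B) {x : Module.End ℂ H}
    (hx : x ∈ B) : star x ∈ B := by
  obtain ⟨f, hf, hfB⟩ := h.exists_preSubgroup_of_isLeftCoideal hB
  have key : ∀ y, y ∈ B ↔ y ∈ V.G e f := fun y => by rw [hfB]; rfl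
  rw [key] at hx ⊢
  obtain ⟨hxS, hxf⟩ := V.mem_G_iff.1 hx
  refine V.mem_G_iff.2 ⟨V.adjoint_mem_spaceS hxS, ?_⟩
  rw [LinearMap.star_eq_adjoint, ← h.modConj_apply_of_mem hxS]
  exact h.modConj_mem_lowerSpace hf hxf

/-- The image of a subalgebra under the antipode. -/
def antipodeSubalgebra (h : StandardPair V e e') (B : Subalgebra ℂ (Module.End ℂ H)) :
    Subalgebra ℂ (Module.End ℂ H) where
  -- The preimage is also the image, since `antipode` is involutive.
  carrier := {x | V.antipode e e' x ∈ B}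
  mul_mem' {x y} hx hy := by
    change V.antipode e e' (x * y) ∈ B
    rw [h.antipode_mul]
    exact B.mul_mem hy hx
  add_mem' {x y} hx hy := by
    have : V.antipode e e' (x + y) = V.antipode e e' x + V.antipode e e' y := by
      refine LinearMap.ext fun ξ => ?_
      simp only [antipode_apply, map_add, LinearMap.add_apply]
    change V.antipode e e' (x + y) ∈ B
    rw [this]
    exact B.add_mem hx hy
  algebraMap_mem' r := by
    have : V.antipode e e' (algebraMap ℂ _ r) = algebraMap ℂ _ r := by
      rw [Algebra.algebraMap_eq_smul_one]
      conv_rhs => rw [← h.antipode_one]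
      refine LinearMap.ext fun ξ => ?_
      simp [antipode_apply, LinearMap.adjoint.map_smulₛₗ]
    change V.antipode e e' _ ∈ B
    rw [this]
    exact B.algebraMap_mem r

theorem mem_antipodeSubalgebra (h : StandardPair V e e') {B : Subalgebra ℂ (Module.End ℂ H)}
    {x : Module.End ℂ H} : x ∈ h.antipodeSubalgebra B ↔ V.antipode e e' x ∈ B := Iff.rfl

theorem antipodeSubalgebra_antipodeSubalgebra (h : StandardPair V e e')
    (B : Subalgebra ℂ (Module.End ℂ H)) :
    h.antipodeSubalgebra (h.antipodeSubalgebra B) = B := by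
  ext x
  rw [mem_antipodeSubalgebra, mem_antipodeSubalgebra, h.antipode_antipode]

theorem antipodeSubalgebra_le (h : StandardPair V e e') {B : Subalgebra ℂ (Module.End ℂ H)}
    (hB : B ≤ V.S.toSubalgebra) : h.antipodeSubalgebra B ≤ V.S.toSubalgebra :=
  fun _ hx => h.antipode_mem_iff.1 (hB hx)

theorem antipode_ofVec (h : StandardPair V e e') (ξ : H) :
    V.antipode e e' (V.ofVec e' ξ) = V.ofVec e' (h.antipodeUnitary ξ) := by
  refine h.ext (h.antipode_mem (V.ofVec_mem _ _)) (V.ofVec_mem _ _) ?_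
  rw [h.antipode_apply_fixed (V.ofVec_mem _ _), h.ofVec_apply, h.ofVec_apply]

/-- On vectors the antipode is `U = J Ĵ`. As `J` normalizes `Ŝ`, conjugation by `U` carries `Ŝ` onto
`Ĵ Ŝ Ĵ` and exchanges the two stability conditions. -/
theorem isLeftCoideal_antipodeSubalgebra (h : StandardPair V e e')
    {B : Subalgebra ℂ (Module.End ℂ H)} (hB : V.IsRightCoideal B) :
    V.IsLeftCoideal (h.antipodeSubalgebra B) := by
  have hle := h.antipodeSubalgebra_le hB.1
  refine ⟨hle, (h.leftCoideal_iff (B := Subalgebra.toSubmodule (h.antipodeSubalgebra B))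
    hle).2 fun x hx ξ => ?_⟩
  have hR := (h.rightCoideal_iff (B := Subalgebra.toSubmodule B) hB.1).1 hB.2 _ hx
    (V.modConj e e' ξ)
  change V.antipode e e' _ ∈ B
  rw [h.antipode_ofVec, antipodeUnitary_apply, h.dual.modConj_modConj, h.modConj_ofVec_dual,
    ← antipodeUnitary_apply h, ← h.antipode_apply_fixed (hle hx)]
  exact hR

theorem isRightCoideal_antipodeSubalgebra (h : StandardPair V e e')
    {B : Subalgebra ℂ (Module.End ℂ H)} (hB : V.IsLeftCoideal B) :
    V.IsRightCoideal (h.antipodeSubalgebra B) := by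
  have hle := h.antipodeSubalgebra_le hB.1
  refine ⟨hle, (h.rightCoideal_iff (B := Subalgebra.toSubmodule (h.antipodeSubalgebra B))
    hle).2 fun x hx ξ => ?_⟩
  have hL := (h.leftCoideal_iff (B := Subalgebra.toSubmodule B) hB.1).1 hB.2 _ hx
    (V.modConj e e' ξ)
  change V.antipode e e' _ ∈ B
  rw [h.antipode_ofVec, antipodeUnitary_apply, h.modConj_comm, h.modConj_ofVec_dual]
  rw [h.antipode_apply_fixed (hle hx), antipodeUnitary_apply, h.modConj_comm,
    h.dual.modConj_modConj] at hL
  exact hL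

/-- In other words `D_f = κ(G_f)`, because `U² = 1`. -/
theorem mem_D_iff (h : StandardPair V e e') {x : Module.End ℂ H} :
    x ∈ V.D e h.antipodeUnitary f ↔ V.antipode e e' x ∈ V.G e f := by
  have h0 : x ∈ V.D e h.antipodeUnitary f ↔
      x ∈ V.spaceS ∧ ∃ η ∈ V.lowerSpace f, h.antipodeUnitary η = x e := Iff.rfl
  rw [h0, V.mem_G_iff, h.antipode_mem_iff]
  refine and_congr_right fun hx => ?_
  rw [h.antipode_apply_fixed hx]
  constructor
  · rintro ⟨η, hη, hηx⟩
    rwa [← hηx, h.antipodeUnitary_antipodeUnitary]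
  · intro hη
    exact ⟨_, hη, h.antipodeUnitary_antipodeUnitary _⟩

theorem D_eq_antipodeSubalgebra (h : StandardPair V e e') {B : Subalgebra ℂ (Module.End ℂ H)}
    (hB : V.G e f = Subalgebra.toSubmodule B) :
    V.D e h.antipodeUnitary f = Subalgebra.toSubmodule (h.antipodeSubalgebra B) := by
  ext x
  rw [h.mem_D_iff, hB]
  rfl

theorem bijOn_D (h : StandardPair V e e') :
    Set.BijOn (fun f => V.D e h.antipodeUnitary f) (V.preSubgroups e)
      (Subalgebra.toSubmodule '' {B | V.IsRightCoideal B}) := by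
  refine ⟨fun f hf => ?_, fun f hf f' hf' hff => ?_, ?_⟩
  · obtain ⟨B, hB, hBf⟩ := h.bijOn_G.mapsTo hf
    exact ⟨_, h.isRightCoideal_antipodeSubalgebra hB, (h.D_eq_antipodeSubalgebra hBf.symm).symm⟩
  · refine h.bijOn_G.injOn hf hf' ?_
    ext x
    have hx : V.antipode e e' x ∈ V.D e h.antipodeUnitary f ↔
        V.antipode e e' x ∈ V.D e h.antipodeUnitary f' := by
      have hff' : V.D e h.antipodeUnitary f = V.D e h.antipodeUnitary f' := hff
      rw [hff']
    rwa [h.mem_D_iff, h.mem_D_iff, h.antipode_antipode] at hx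
  · rintro _ ⟨B, hB, rfl⟩
    obtain ⟨f, hf, hfB⟩ :=
      h.exists_preSubgroup_of_isLeftCoideal (h.isLeftCoideal_antipodeSubalgebra hB)
    refine ⟨f, hf, ?_⟩
    change V.D e h.antipodeUnitary f = _
    rw [h.D_eq_antipodeSubalgebra hfB, h.antipodeSubalgebra_antipodeSubalgebra]

theorem star_mem_of_isRightCoideal (h : StandardPair V e e')
    {B : Subalgebra ℂ (Module.End ℂ H)} (hB : V.IsRightCoideal B) {x : Module.End ℂ H}
    (hx : x ∈ B) : star x ∈ B := by
  have hx' : V.antipode e e' x ∈ h.antipodeSubalgebra B := by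
    rwa [mem_antipodeSubalgebra, h.antipode_antipode]
  have h1 := h.star_mem_of_isLeftCoideal (h.isLeftCoideal_antipodeSubalgebra hB) hx'
  rwa [LinearMap.star_eq_adjoint, h.adjoint_antipode, mem_antipodeSubalgebra,
    h.antipode_antipode] at h1

end StandardPair

/-! ### Transfer to `Ŝ`: the coproduct of the dual is the flip of `δ̂`, so left and right coideals
change places. -/

theorem dual_isLeftCoideal_iff (V : MultiplicativeUnitary H)
    (B : Subalgebra ℂ (Module.End ℂ H)) : V.dual.IsLeftCoideal B ↔ V.IsRightCoidealHat B := by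
  have h1 : B ≤ V.dual.S.toSubalgebra ↔ B ≤ V.SHat.toSubalgebra := by
    change Subalgebra.toSubmodule B ≤ V.dual.spaceS ↔ Subalgebra.toSubmodule B ≤ V.spaceSHat
    rw [dual_spaceS]
  rw [IsLeftCoideal, IsRightCoidealHat, h1, toSubmodule_S, toSubmodule_SHat, dual_spaceS]
  simp only [dual_comul, flipEnd_mem_tensorSpan]

theorem dual_isRightCoideal_iff (V : MultiplicativeUnitary H)
    (B : Subalgebra ℂ (Module.End ℂ H)) : V.dual.IsRightCoideal B ↔ V.IsLeftCoidealHat B := by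
  have h1 : B ≤ V.dual.S.toSubalgebra ↔ B ≤ V.SHat.toSubalgebra := by
    change Subalgebra.toSubmodule B ≤ V.dual.spaceS ↔ Subalgebra.toSubmodule B ≤ V.spaceSHat
    rw [dual_spaceS]
  rw [IsRightCoideal, IsLeftCoidealHat, h1, toSubmodule_S, toSubmodule_SHat, dual_spaceS]
  simp only [dual_comul, flipEnd_mem_tensorSpan]

theorem dual_G (V : MultiplicativeUnitary H) (e' f : H) : V.dual.G e' f = V.DHat e' f := by
  rw [G, DHat, toSubmodule_S, toSubmodule_SHat, dual_spaceS, dual_lowerSpace]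

theorem dual_D (V : MultiplicativeUnitary H) (e' f : H) (U : H ≃ₗᵢ[ℂ] H) :
    V.dual.D e' U f = V.GHat e' U f := by
  rw [D, GHat, toSubmodule_S, toSubmodule_SHat, dual_spaceS, dual_lowerSpace]

end MultiplicativeUnitary

end

/-- `e` is a fixed unit vector and `e'` (written `ê` in the comments of the definitions) is the
cofixed unit vector with `⟨e, ê⟩ = n ^ (-1/2)`, where `n = dim H`. -/
theorem proposition4p3 {H : Type*} [NormedAddCommGroup H] [InnerProductSpace ℂ H]
    [FiniteDimensional ℂ H] (V : MultiplicativeUnitary H) (hV : V.multiplicity = 1)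
    (e e' : H) (he : e ∈ V.fixedSpace) (he_norm : ‖e‖ = 1)
    (he' : V.IsCofixed e') (he'_norm : ‖e'‖ = 1)
    (hee' : inner ℂ e e' = (((Real.sqrt (Module.finrank ℂ H))⁻¹ : ℝ) : ℂ)) :
    (∃! U : H ≃ₗᵢ[ℂ] H, V.IsAntipodeUnitary e U) ∧
    (∀ U : H ≃ₗᵢ[ℂ] H, V.IsAntipodeUnitary e U →
      Set.BijOn (fun f => V.D e U f) (V.preSubgroups e)
        (Subalgebra.toSubmodule '' {B | V.IsRightCoideal B}) ∧
      Set.BijOn (fun f => V.G e f) (V.preSubgroups e)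
        (Subalgebra.toSubmodule '' {B | V.IsLeftCoideal B}) ∧
      Set.BijOn (fun f => V.DHat e' f) (V.preSubgroups e)
        (Subalgebra.toSubmodule '' {B | V.IsRightCoidealHat B}) ∧
      Set.BijOn (fun f => V.GHat e' U f) (V.preSubgroups e)
        (Subalgebra.toSubmodule '' {B | V.IsLeftCoidealHat B})) ∧
    (∀ B : Subalgebra ℂ (Module.End ℂ H), V.IsRightCoideal B ∨ V.IsLeftCoideal B →
      ∀ x ∈ B, star x ∈ B) := by
  have h : MultiplicativeUnitary.StandardPair V e e' :=
    ⟨hV, he, he_norm, he', he'_norm, hee'⟩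
  refine ⟨⟨h.antipodeUnitary, h.isAntipodeUnitary, fun U hU => h.antipodeUnitary_unique hU⟩, ?_, ?_⟩
  · intro U hU
    obtain rfl := h.antipodeUnitary_unique hU
    refine ⟨h.bijOn_D, h.bijOn_G, ?_, ?_⟩
    · have h1 := h.dual.bijOn_G
      simpa only [h.dual_preSubgroups, MultiplicativeUnitary.dual_G,
        MultiplicativeUnitary.dual_isLeftCoideal_iff] using h1
    · have h1 := h.dual.bijOn_D
      simpa only [h.dual_preSubgroups, h.dual_antipodeUnitary, MultiplicativeUnitary.dual_D,
        MultiplicativeUnitary.dual_isRightCoideal_iff] using h1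
  · rintro B (hB | hB) x hx
    · exact h.star_mem_of_isRightCoideal hB hx
    · exact h.star_mem_of_isLeftCoideal hB hx
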